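/- **Large deviations principles.** A sequence $\{\tau_n\}$ of probability measures on the Borel $\sigma$-algebra of $\mathbb R$ satisfies a (full) large deviations principle (LDP) with rate function $\rho$ if $\rho:\mathbb R\to[0,\infty]$ is lower semicontinuous (its level sets are not required to be compact) and $$\limsup_{n\to\infty}\tfrac1n\log\tau_n(F)\le-\inf_{a\in F}\rho(a),\qquad \liminf_{n\to\infty}\tfrac1n\log\tau_n(G)\ge-\inf_{a\in G}\rho(a)$$ for all closed $F\subset\mathbb R$ and all open $G\subset\mathbb R$ (with $\log 0=-\infty$). Random variables satisfy an LDP if their laws do. **Model.** Let $\mathcal E$ be a metric space, let $\lambda,\kappa,\mu:\mathcal E\to[0,\infty)$ be continuous, and let $J=(J(s))_{s\ge0}$ be an $\mathcal E$-valued stochastic process with càdlàg paths. In the modulated infinite-server queue $(J,\lambda,\kappa,\mu)$, starting empty, job $k$ ($k\ge1$) arrives at time $\tau_k=\inf\{s\ge0:\int_0^s\lambda(J(r))\,dr\ge\bar\tau_k\}$ (with $\inf\emptyset=\infty$), where $\bar\tau_1<\bar\tau_2<\cdots$ are the jump times of a standard (unit-rate) Poisson process. Its service requirement is $Z_k=\bar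 Z_k/\kappa(J(\tau_k))$ if $\kappa(J(\tau_k))>0$ and $Z_k=\infty$ otherwise, where $\bar Z_1,\bar Z_2,\dots$ are i.i.d. standard exponential random variables; $J$, the Poisson process and $(\bar Z_k)_k$ are independent. The number of jobs in the system at time $t\ge0$ is $$M(t)=\#\Bigl\{k\ge1:\ \tau_k\le t,\ Z_k>\int_{\tau_k}^t\mu(J(r))\,dr\Bigr\}.$$ **Theorem.** Fix $t\ge0$. For $n\in\mathbb N$ let $J_n$ be an $\mathcal E$-valued càdlàg process, let $M_n(t)$ be the number of jobs at time $t$ in the queue $(J_n,n\lambda,\kappa,\mu)$, and let $\nu_n$ be the law of $$\phi_t(J_n)=\int_0^t\lambda(J_n(s))\exp\Bigl(-\kappa(J_n(s))\int_s^t\mu(J_n(r))\,dr\Bigr)ds .$$ Suppose that $\{\nu_n\}$ satisfies an LDP with rate function $\psi$ (not necessarily good). Let $\mathcal R(t)$ be the set of attainable parameters: all $\gamma\in[0,\infty)$ such that for every $\epsilon>0$ there is $N_\epsilon$ with $\nu_n\bigl((\gamma-\epsilon,\gamma+\epsilon)\bigr)>0$ for all $n\ge N_\epsilon$. For $\gamma\ge0$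 let $\ell(\gamma;\cdot)$ be the Fenchel–Legendre transform of the cumulant generating function of the Poisson distribution with parameter $\gamma$, i.e. $\ell(\gamma;a)=\sup_{\theta\in\mathbb R}[\theta a-\gamma(e^\theta-1)]$. Then $\frac1nM_n(t)$ satisfies an LDP with rate function $$I(a)=\inf_{\gamma\in\mathcal R(t)}\bigl[\ell(\gamma;a)+\psi(\gamma)\bigr],\qquad a\in\mathbb R .$$ -/

import Mathlib

open MeasureTheory ProbabilityTheory Filter Topology Set
open scoped NNReal ENNReal

namespace ModulatedQueue

noncomputable section

/-! ### Large deviations principles -/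

/-- A sequence `τ` of Borel measures on `X` satisfies a (full) large deviations principle with
rate function `ρ : X → [0, ∞]`: `ρ` is lower semicontinuous (its level sets need not be compact),
and the upper bound holds for all closed sets, the lower bound for all open sets.
Here `ENNReal.log 0 = -∞`, and the infimum over the empty set is `∞`. -/
structure SatisfiesLDP {X : Type*} [TopologicalSpace X] [MeasurableSpace X]
    (τ : ℕ → Measure X) (ρ : X → ℝ≥0∞) : Prop where
  lowerSemicontinuous : LowerSemicontinuous ρ
  upper_bound : ∀ F : Set X, IsClosed F →
    limsup (fun n : ℕ => ENNReal.log (τ n F) / (n : EReal)) atTop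
      ≤ -((⨅ a ∈ F, ρ a : ℝ≥0∞) : EReal)
  lower_bound : ∀ G : Set X, IsOpen G →
    -((⨅ a ∈ G, ρ a : ℝ≥0∞) : EReal)
      ≤ liminf (fun n : ℕ => ENNReal.log (τ n G) / (n : EReal)) atTop

/-- The Fenchel-Legendre transform `a ↦ sup_θ [θ a - Λ(θ)]` of the cumulant generating function
`Λ` of the Poisson distribution with parameter `γ ≥ 0`. The supremum is nonnegative because the
term at `θ = 0` vanishes, so truncating each term at `0` does not change it. -/
def poissonRate (γ : ℝ≥0) (a : ℝ) : ℝ≥0∞ :=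
  ⨆ θ : ℝ, ENNReal.ofReal (θ * a - cgf (fun k : ℕ => (k : ℝ)) (poissonMeasure γ) θ)

/-- `γ ≥ 0` is attainable for the sequence `ν` of laws of the random parameter: every ball around
`γ` is charged by all but finitely many of the measures. -/
def attainable (ν : ℕ → Measure ℝ) : Set ℝ≥0 :=
  {γ | ∀ ε : ℝ, 0 < ε → ∃ N : ℕ, ∀ n ≥ N, 0 < ν n (Metric.ball (γ : ℝ) ε)}

/-- The function `I(a) = inf_{γ attainable} [ℓ(γ; a) + ψ(γ)]`. -/
def mixedRate (ν : ℕ → Measure ℝ) (ψ : ℝ → ℝ≥0∞) (a : ℝ) : ℝ≥0∞ :=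
  ⨅ γ ∈ attainable ν, (poissonRate γ a + ψ (γ : ℝ))

/-! ### The queue, path by path -/

section Path

variable {E : Type*}

/-- Càdlàg paths `[0, ∞) → E`: right-continuous with left limits in `E`. -/
def IsCadlag [TopologicalSpace E] (f : ℝ≥0 → E) : Prop :=
  ∀ t, ContinuousWithinAt f (Ici t) t ∧ ∃ l, Tendsto f (𝓝[<] t) (𝓝 l)

/-- The integral `∫_u^v c(f(r)) dr` of the modulated rate `c` along the background path `f`. -/
def cumulative (c : E → ℝ≥0) (f : ℝ≥0 → E) (u v : ℝ≥0) : ℝ :=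
  ∫ r in (u : ℝ)..(v : ℝ), (c (f r.toNNReal) : ℝ)

/-- The random parameter
`φ_t(f) = ∫_0^t lam(f(s)) exp(-kap(f(s)) ∫_s^t mu(f(r)) dr) ds`. -/
def randomParameter (lam kap mu : E → ℝ≥0) (t : ℝ≥0) (f : ℝ≥0 → E) : ℝ :=
  ∫ s in (0 : ℝ)..(t : ℝ), (lam (f s.toNNReal) : ℝ) *
    Real.exp (-((kap (f s.toNNReal) : ℝ) * cumulative mu f s.toNNReal t))

/-- The time of arrival `τ_k = inf {s ≥ 0 | ∫_0^s lam(f(r)) dr ≥ τbar_k}` of job `k`, where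
`τbar_k = σ_0 + ... + σ_k` is the `k`-th jump time of the unit-rate Poisson process with
interarrival times `σ`, and jobs are numbered from `0`. It is the `k`-th jump time of the
time-changed process, and is `∞` if job `k` never arrives. -/
def arrivalTime (lam : E → ℝ≥0) (f : ℝ≥0 → E) (σ : ℕ → ℝ) (k : ℕ) : ℝ≥0∞ :=
  ⨅ (s : ℝ≥0) (_ : ∑ i ∈ Finset.range (k + 1), σ i ≤ cumulative lam f 0 s), (s : ℝ≥0∞)

/-- The service requirement of a job that arrives when the background process is in state `x`,
where `z` is its standard exponential variable: `z / kap(x)`, or `∞` if `kap(x) = 0`. -/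
def serviceRequirement (kap : E → ℝ≥0) (x : E) (z : ℝ) : EReal :=
  if 0 < kap x then ((z / (kap x : ℝ) : ℝ) : EReal) else ⊤

/-- The number of jobs in the system at time `t`: the number of `k` such that job `k` has arrived
by time `t`, and the work done by its server since then is less than its service requirement. -/
def jobsInSystem (lam kap mu : E → ℝ≥0) (f : ℝ≥0 → E) (σ z : ℕ → ℝ) (t : ℝ≥0) : ℕ :=
  {k : ℕ | arrivalTime lam f σ k ≤ (t : ℝ≥0∞) ∧
    ((cumulative mu f (arrivalTime lam f σ k).toNNReal t : ℝ) : EReal)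
      < serviceRequirement kap (f (arrivalTime lam f σ k).toNNReal) (z k)}.ncard

end Path

/-! ### The stochastic ingredients of the queue -/

/-- The random input of a modulated infinite-server queue on `(Ω, P)`: a background process `J`
with càdlàg paths, the interarrival times `σ` of a standard Poisson process (i.i.d. standard
exponential), and i.i.d. standard exponential variables `Z` for the service requirements,
the three being independent. -/
structure IsQueueInput {Ω E : Type*} [MeasurableSpace Ω] [TopologicalSpace E] [MeasurableSpace E]
    (P : Measure Ω) (J : ℝ≥0 → Ω → E) (σ Z : ℕ → Ω → ℝ) : Prop where
  measurable_background : ∀ s, Measurable (J s)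
  cadlag : ∀ ω, IsCadlag (fun s => J s ω)
  measurable_interarrival : ∀ k, Measurable (σ k)
  measurable_service : ∀ k, Measurable (Z k)
  law_interarrival : ∀ k, HasLaw (σ k) (expMeasure 1) P
  law_service : ∀ k, HasLaw (Z k) (expMeasure 1) P
  /-- All the exponential variables are mutually independent. -/
  indep_exponentials : iIndepFun (fun i : ℕ ⊕ ℕ => Sum.elim σ Z i) P
  /-- The background process is independent of the exponential variables jointly. -/
  indep_background : IndepFun (fun ω (s : ℝ≥0) => J s ω)
    (fun ω (i : ℕ ⊕ ℕ) => Sum.elim σ Z i ω) P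

/-- The law of `φ_t(J)`. -/
def parameterLaw {Ω E : Type*} [MeasurableSpace Ω] (P : Measure Ω) (lam kap mu : E → ℝ≥0)
    (J : ℝ≥0 → Ω → E) (t : ℝ≥0) : Measure ℝ :=
  P.map (fun ω => randomParameter lam kap mu t (fun s => J s ω))

/-- The law of `M_n(t) / n`, where `M_n(t)` is the number of jobs at time `t` in the queue with
arrival rate `n * lam` and background process `J`. -/
def scaledJobsLaw {Ω E : Type*} [MeasurableSpace Ω] (P : Measure Ω) (lam kap mu : E → ℝ≥0)
    (J : ℝ≥0 → Ω → E) (σ Z : ℕ → Ω → ℝ) (t : ℝ≥0) (n : ℕ) : Measure ℝ :=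
  P.map (fun ω => (jobsInSystem (fun x => (n : ℝ≥0) * lam x) kap mu (fun s => J s ω)
    (fun k => σ k ω) (fun k => Z k ω) t : ℝ) / (n : ℝ))

end

end ModulatedQueue

namespace ModulatedQueue

/-! ### Exponential rates -/

/-! Conditionally on the background path, the number of jobs is Poisson with parameter `n *
φ_t(J_n)`. On the time scale of the unit-rate Poisson process, a job arriving at `u` is still
present with a probability `p(u)` depending only on the path, so by thinning the count is Poisson
with mean `∫ p` up to `∫_0^t nλ` (`map_markedCount`). The substitution `u = ∫_0^s nλ` turns this
mean into `n * φ_t` (`integral_markProb_inSystem`). Hence the law of `M_n(t) / n` is a mixture of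
scaled Poisson laws over `ν_n`, and the rest is a statement about such mixtures
(`satisfiesLDP_mixedPoisson`).

Lower bound: for `γ` and `a ∈ G`, keep only the parameters near `γ`. Stirling's formula bounds the
Poisson probability of one lattice point near `n * a`, uniformly over these parameters, and the LDP
of `ν_n` bounds the mass of the ball.

Upper bound: `ψ` need not be good, so no reduction to compact sets of parameters is available.
Instead the parameters are sliced by the cost of reaching `F`: `C_i` consists of the `γ` with `ℓ(γ;
a) ≤ i * d` for some `a ∈ F`. Each `C_i` is closed, because bounded `γ` and bounded cost force
bounded `a`, so the LDP of `ν_n` applies to it. Outside `C_i` the Chernoff bound holds at rate `i *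
d` with a constant free of `γ`. Finitely many slices suffice.

Lower semicontinuity of `I` comes from the dual fact that bounded `a` and bounded cost force bounded
`γ`. The restriction to attainable parameters is harmless: where `ψ` is finite, the lower bound on
balls makes `γ` attainable. -/

lemma log_div_natCast_le_iff {u : ℝ≥0∞} {n : ℕ} (hn : 0 < n) (x : ℝ) :
    ENNReal.log u / (n : EReal) ≤ ((-x : ℝ) : EReal) ↔
      u ≤ ENNReal.ofReal (Real.exp (-(n * x))) := by
  rw [EReal.div_le_iff_le_mul (by exact_mod_cast hn) (EReal.natCast_ne_top n),
    ← EReal.exp_coe, ← ENNReal.log_le_log_iff, EReal.log_exp]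
  rw [show ((-(n * x) : ℝ) : EReal) = (n : EReal) * ((-x : ℝ) : EReal) by
    rw [← EReal.coe_natCast, ← EReal.coe_mul]; congr 1; ring]

lemma le_log_div_natCast_iff {u : ℝ≥0∞} {n : ℕ} (hn : 0 < n) (x : ℝ) :
    ((-x : ℝ) : EReal) ≤ ENNReal.log u / (n : EReal) ↔
      ENNReal.ofReal (Real.exp (-(n * x))) ≤ u := by
  rw [EReal.le_div_iff_mul_le (by exact_mod_cast hn) (EReal.natCast_ne_top n),
    ← EReal.exp_coe, ← ENNReal.log_le_log_iff, EReal.log_exp]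
  rw [show ((-(n * x) : ℝ) : EReal) = ((-x : ℝ) : EReal) * (n : EReal) by
    rw [← EReal.coe_natCast, ← EReal.coe_mul]; congr 1; ring]

lemma neg_coe_lt_coe_neg {r : ℝ≥0∞} {x : ℝ≥0} (h : (x : ℝ≥0∞) < r) :
    -(r : EReal) < ((-(x : ℝ) : ℝ) : EReal) := by
  rw [EReal.coe_neg, EReal.neg_lt_neg_iff]
  rw [← EReal.coe_nnreal_eq_coe_real]
  exact EReal.coe_ennreal_lt_coe_ennreal_iff.2 h

lemma coe_neg_lt_neg_coe {r : ℝ≥0∞} {x : ℝ≥0} (h : r < (x : ℝ≥0∞)) :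
    ((-(x : ℝ) : ℝ) : EReal) < -(r : EReal) := by
  rw [EReal.coe_neg, EReal.neg_lt_neg_iff]
  rw [← EReal.coe_nnreal_eq_coe_real]
  exact EReal.coe_ennreal_lt_coe_ennreal_iff.2 h

lemma eventually_le_exp_of_limsup_le {u : ℕ → ℝ≥0∞} {r : ℝ≥0∞}
    (h : limsup (fun n : ℕ => ENNReal.log (u n) / (n : EReal)) atTop ≤ -(r : EReal))
    {x : ℝ≥0} (hx : (x : ℝ≥0∞) < r) :
    ∀ᶠ n : ℕ in atTop, u n ≤ ENNReal.ofReal (Real.exp (-(n * (x : ℝ)))) := by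
  filter_upwards [eventually_lt_of_limsup_lt (h.trans_lt (neg_coe_lt_coe_neg hx)),
    eventually_gt_atTop 0] with n hn hn0
  exact (log_div_natCast_le_iff hn0 _).1 hn.le

lemma eventually_exp_le_of_le_liminf {u : ℕ → ℝ≥0∞} {r : ℝ≥0∞}
    (h : -(r : EReal) ≤ liminf (fun n : ℕ => ENNReal.log (u n) / (n : EReal)) atTop)
    {x : ℝ≥0} (hx : r < (x : ℝ≥0∞)) :
    ∀ᶠ n : ℕ in atTop, ENNReal.ofReal (Real.exp (-(n * (x : ℝ)))) ≤ u n := by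
  filter_upwards [eventually_lt_of_lt_liminf ((coe_neg_lt_neg_coe hx).trans_le h),
    eventually_gt_atTop 0] with n hn hn0
  exact (le_log_div_natCast_iff hn0 _).1 hn.le

lemma le_liminf_of_eventually_exp_le {u : ℕ → ℝ≥0∞} {r : ℝ≥0∞}
    (h : ∀ x : ℝ≥0, r < (x : ℝ≥0∞) →
      ∀ᶠ n : ℕ in atTop, ENNReal.ofReal (Real.exp (-(n * (x : ℝ)))) ≤ u n) :
    -(r : EReal) ≤ liminf (fun n : ℕ => ENNReal.log (u n) / (n : EReal)) atTop := by
  refine le_of_forall_lt fun c hc => ?_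
  obtain ⟨y, hcy, hy⟩ := EReal.lt_iff_exists_real_btwn.1 hc
  have hy' : (r : EReal) < ((-y : ℝ) : EReal) := by
    rw [EReal.coe_neg]; exact EReal.lt_neg_comm.1 hy
  have hy0 : 0 ≤ -y := by
    have : (0 : EReal) < ((-y : ℝ) : EReal) := (EReal.coe_ennreal_nonneg r).trans_lt hy'
    exact_mod_cast this.le
  obtain ⟨x, hx⟩ : ∃ x : ℝ≥0, (x : ℝ) = -y := ⟨⟨-y, hy0⟩, rfl⟩
  have hr : r < (x : ℝ≥0∞) := by
    rw [← EReal.coe_ennreal_lt_coe_ennreal_iff, EReal.coe_nnreal_eq_coe_real, hx]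
    exact hy'
  refine hcy.trans_le (le_liminf_of_le (by isBoundedDefault) ?_)
  filter_upwards [h _ hr, eventually_gt_atTop 0] with n hn hn0
  have := (le_log_div_natCast_iff hn0 _).2 hn
  rwa [hx, neg_neg] at this

/-- The prefactor `C` is absorbed by the gap between `x` and any smaller rate: `exp (n * gap)`
eventually exceeds `C`. -/
lemma limsup_le_of_eventually_le_mul_exp {u : ℕ → ℝ≥0∞} {r : ℝ≥0∞} (hu : ∀ n, u n ≤ 1)
    (h : ∀ x : ℝ≥0, (x : ℝ≥0∞) < r → ∃ C : ℝ, 0 < C ∧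
      ∀ᶠ n : ℕ in atTop, u n ≤ ENNReal.ofReal (C * Real.exp (-(n * (x : ℝ))))) :
    limsup (fun n : ℕ => ENNReal.log (u n) / (n : EReal)) atTop ≤ -(r : EReal) := by
  refine le_of_forall_gt fun c hc => ?_
  obtain ⟨y, hy, hcy⟩ := EReal.lt_iff_exists_real_btwn.1 hc
  refine lt_of_le_of_lt (limsup_le_of_le (by isBoundedDefault) ?_) hcy
  -- For `y > 0` the rate `-y` is not in `ℝ≥0`, and the trivial bound `u n ≤ 1` already suffices.
  rcases lt_or_ge 0 y with hy0 | hy0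
  · filter_upwards [eventually_gt_atTop 0] with n hn0
    have := (log_div_natCast_le_iff (u := u n) hn0 (-y)).2 ((hu n).trans (by
      rw [← ENNReal.ofReal_one]
      exact ENNReal.ofReal_le_ofReal (Real.one_le_exp (by
        have : (0 : ℝ) ≤ n := n.cast_nonneg
        nlinarith))))
    simpa using this
  · have hy' : ((-y : ℝ) : EReal) < (r : EReal) := by
      rw [EReal.coe_neg]; exact EReal.neg_lt_comm.1 hy
    obtain ⟨z, hz⟩ : ∃ z : ℝ≥0, (z : ℝ) = -y := ⟨⟨-y, by linarith⟩, rfl⟩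
    have hr : (z : ℝ≥0∞) < r := by
      rw [← EReal.coe_ennreal_lt_coe_ennreal_iff, EReal.coe_nnreal_eq_coe_real, hz]
      exact hy'
    obtain ⟨x, hx1, hx2⟩ := ENNReal.lt_iff_exists_nnreal_btwn.1 hr
    obtain ⟨C, hC, hev⟩ := h x hx2
    have hx1' : -y < (x : ℝ) := by rw [← hz]; exact_mod_cast hx1
    have hlim : Tendsto (fun n : ℕ => (n : ℝ) * (x + y)) atTop atTop :=
      tendsto_natCast_atTop_atTop.atTop_mul_const (by linarith)
    filter_upwards [hev, eventually_gt_atTop 0, hlim.eventually_ge_atTop (Real.log C)]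
      with n hn hn0 hlog
    have := (log_div_natCast_le_iff (u := u n) hn0 (-y)).2 (hn.trans (by
      refine ENNReal.ofReal_le_ofReal ?_
      rw [← Real.exp_log hC, ← Real.exp_add]
      exact Real.exp_le_exp.2 (by linarith)))
    simpa using this

/-! ### The Poisson rate function -/

/-- The Fenchel-Legendre transform of `θ ↦ γ (exp θ - 1)`, for any real `γ`. -/
noncomputable def expRate (γ a : ℝ) : ℝ≥0∞ :=
  ⨆ θ : ℝ, ENNReal.ofReal (θ * a - γ * (Real.exp θ - 1))

lemma hasSum_exp_mul_poisson (r : ℝ≥0) (θ : ℝ) :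
    HasSum (fun k : ℕ => Real.exp (-r) * r ^ k / k.factorial * Real.exp (θ * k))
      (Real.exp (r * (Real.exp θ - 1))) := by
  have h := (NormedSpace.expSeries_div_hasSum_exp (r * Real.exp θ)).mul_left (Real.exp (-(r : ℝ)))
  rw [← Real.exp_eq_exp_ℝ, ← Real.exp_add] at h
  convert! h using 1
  · funext k
    rw [mul_pow, ← Real.exp_nat_mul, mul_comm θ]
    ring
  · congr 1; ring

lemma integrable_exp_mul_poissonMeasure (r : ℝ≥0) (θ : ℝ) :
    Integrable (fun k : ℕ => Real.exp (θ * k)) (poissonMeasure r) := by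
  rw [integrable_poissonMeasure_iff]
  simpa [abs_of_pos (Real.exp_pos _)] using (hasSum_exp_mul_poisson r θ).summable

lemma mgf_poissonMeasure (r : ℝ≥0) (θ : ℝ) :
    mgf (fun k : ℕ => (k : ℝ)) (poissonMeasure r) θ = Real.exp (r * (Real.exp θ - 1)) := by
  have h := hasSum_integral_poissonMeasure (integrable_exp_mul_poissonMeasure r θ)
  exact h.unique (by simpa using hasSum_exp_mul_poisson r θ)

lemma cgf_poissonMeasure (r : ℝ≥0) (θ : ℝ) :
    cgf (fun k : ℕ => (k : ℝ)) (poissonMeasure r) θ = r * (Real.exp θ - 1) := by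
  rw [cgf, mgf_poissonMeasure, Real.log_exp]

lemma poissonRate_eq_expRate (γ : ℝ≥0) (a : ℝ) : poissonRate γ a = expRate γ a := by
  simp only [poissonRate, expRate, cgf_poissonMeasure]

lemma ofReal_le_expRate (γ a θ : ℝ) :
    ENNReal.ofReal (θ * a - γ * (Real.exp θ - 1)) ≤ expRate γ a :=
  le_iSup (fun θ : ℝ => ENNReal.ofReal (θ * a - γ * (Real.exp θ - 1))) θ

lemma le_of_expRate_le {γ a : ℝ} {c : ℝ≥0} (h : expRate γ a ≤ c) (θ : ℝ) :
    θ * a - γ * (Real.exp θ - 1) ≤ c := by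
  have := (ofReal_le_expRate γ a θ).trans h
  rw [← ENNReal.ofReal_coe_nnreal] at this
  exact (ENNReal.ofReal_le_ofReal_iff c.2).1 this

lemma lowerSemicontinuous_expRate :
    LowerSemicontinuous (fun p : ℝ × ℝ => expRate p.1 p.2) := by
  refine lowerSemicontinuous_iSup fun θ => Continuous.lowerSemicontinuous ?_
  exact ENNReal.continuous_ofReal.comp (by fun_prop)

/-- The slopes `θ = 1` and `θ = -1` bound `a` from above and below; `2` dominates `e - 1`. -/
lemma abs_snd_le_of_expRate_le {γ a R : ℝ} {c : ℝ≥0} (h : expRate γ a ≤ c) (hγ : |γ| ≤ R) :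
    |a| ≤ c + 2 * R := by
  have h1 := le_of_expRate_le h 1
  have h2 := le_of_expRate_le h (-1)
  have e1 : Real.exp 1 < 2.7182818286 := Real.exp_one_lt_d9
  have e2 : Real.exp (-1) ≤ 1 := Real.exp_le_one_iff.2 (by norm_num)
  have e3 : 0 < Real.exp (-1) := Real.exp_pos _
  have e4 : 1 < Real.exp 1 := Real.one_lt_exp_iff.2 (by norm_num)
  rw [abs_le] at hγ ⊢
  constructor <;> nlinarith

/-- The same two slopes, now read as bounds on `γ`; the factor `2` comes from `1 - exp (-1) ≥ 1 /
2`. This coercivity in `γ` stands in for goodness of `ψ`. -/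
lemma abs_fst_le_of_expRate_le {γ a R : ℝ} {c : ℝ≥0} (h : expRate γ a ≤ c) (ha : |a| ≤ R) :
    |γ| ≤ 2 * (c + R) := by
  have h1 := le_of_expRate_le h 1
  have h2 := le_of_expRate_le h (-1)
  have e1 : (2.7182818283 : ℝ) < Real.exp 1 := Real.exp_one_gt_d9
  have e2 : Real.exp (-1) ≤ 1 / 2 := by
    rw [Real.exp_neg, inv_le_comm₀ (Real.exp_pos _) (by norm_num)]
    linarith
  have e3 : 0 < Real.exp (-1) := Real.exp_pos _
  have := c.2
  rw [abs_le] at ha ⊢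
  constructor
  · by_contra! hlt
    nlinarith
  · by_contra! hlt
    nlinarith

/-- Local boundedness of the fibres replaces compactness: a convergent sequence in the projection
lifts to a sequence with a convergent subsequence. -/
lemma isClosed_image_fst_of_bounded {K : Set (ℝ × ℝ)} (hK : IsClosed K)
    (hb : ∀ R : ℝ, ∃ R' : ℝ, ∀ p ∈ K, |p.1| ≤ R → |p.2| ≤ R') : IsClosed (Prod.fst '' K) := by
  refine IsSeqClosed.isClosed fun x x₀ hx hlim => ?_
  choose p hpK hp using hx
  obtain ⟨R, hR⟩ := (Metric.isBounded_range_of_tendsto x hlim).exists_norm_le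
  obtain ⟨R', hR'⟩ := hb R
  have hmem : ∀ n, (p n).2 ∈ Icc (-R') R' := fun n =>
    abs_le.1 (hR' _ (hpK n) (by simpa [hp] using hR (x n) (mem_range_self n)))
  obtain ⟨y, -, φ, hφ, hy⟩ := isCompact_Icc.tendsto_subseq hmem
  refine ⟨(x₀, y), ?_, rfl⟩
  refine hK.mem_of_tendsto ((hlim.comp hφ.tendsto_atTop).prodMk_nhds hy)
    (Eventually.of_forall fun n => ?_)
  simpa [← hp] using hpK (φ n)

/-- Parameters for which some point of `F` has cost at most `c`. -/
lemma isClosed_setOf_exists_expRate_le {F : Set ℝ} (hF : IsClosed F) (c : ℝ≥0) :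
    IsClosed {γ : ℝ | ∃ a ∈ F, expRate γ a ≤ c} := by
  have hK : IsClosed {p : ℝ × ℝ | p.2 ∈ F ∧ expRate p.1 p.2 ≤ c} :=
    (hF.preimage continuous_snd).inter (lowerSemicontinuous_expRate.isClosed_preimage c)
  convert! isClosed_image_fst_of_bounded hK fun R =>
    ⟨c + 2 * R, fun p hp h => abs_snd_le_of_expRate_le hp.2 h⟩ using 1
  ext γ
  simp

/-- A sublevel set at `c` is the intersection over `d > c` of projections of sublevel sets of the
sum, so attainment of the infimum is not needed. The projections are closed because `expRate` alone
confines `γ`. -/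
lemma lowerSemicontinuous_iInf_expRate_add {ψ : ℝ → ℝ≥0∞} (hψ : LowerSemicontinuous ψ) :
    LowerSemicontinuous (fun a => ⨅ γ : ℝ, (expRate γ a + ψ γ)) := by
  rw [lowerSemicontinuous_iff_isClosed_preimage]
  intro c
  rcases eq_or_ne c ⊤ with rfl | hc
  · simp
  have hset : ((fun a => ⨅ γ : ℝ, (expRate γ a + ψ γ)) ⁻¹' Iic c) =
      ⋂ (d : ℝ≥0) (_ : c < d), {a | ∃ γ, expRate γ a + ψ γ ≤ d} := by
    ext a
    simp only [mem_preimage, mem_Iic, mem_iInter, mem_ofPred_eq]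
    constructor
    · intro h d hd
      obtain ⟨γ, hγ⟩ := iInf_lt_iff.1 (h.trans_lt hd)
      exact ⟨γ, hγ.le⟩
    · intro h
      refine le_of_forall_gt fun e he => ?_
      obtain ⟨d, hcd, hde⟩ := ENNReal.lt_iff_exists_nnreal_btwn.1 he
      obtain ⟨γ, hγ⟩ := h d hcd
      exact ((iInf_le _ γ).trans hγ).trans_lt hde
  rw [hset]
  refine isClosed_iInter fun d => isClosed_iInter fun _ => ?_
  have hl : LowerSemicontinuous (fun p : ℝ × ℝ => expRate p.2 p.1 + ψ p.2) :=
    (lowerSemicontinuous_expRate.comp continuous_swap).add (hψ.comp continuous_snd)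
  convert! isClosed_image_fst_of_bounded (hl.isClosed_preimage d) fun R =>
    ⟨2 * (d + R), fun p hp h =>
      abs_fst_le_of_expRate_le ((le_add_of_nonneg_right zero_le).trans hp) h⟩ using 1
  ext a
  simp

/-! ### Chernoff bound for closed sets -/

lemma exists_lt_of_lt_expRate {γ a x : ℝ} (h : ENNReal.ofReal x < expRate γ a) :
    ∃ θ : ℝ, x < θ * a - γ * (Real.exp θ - 1) := by
  obtain ⟨θ, hθ⟩ := lt_iSup_iff.1 h
  exact ⟨θ, lt_of_not_ge fun hle => absurd hθ (ENNReal.ofReal_le_ofReal hle).not_gt⟩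

lemma poissonMeasure_ge_le {n : ℕ} {γ : ℝ≥0} {b x : ℝ} (hx : 0 ≤ x) (hb : (γ : ℝ) ≤ b)
    (h : ENNReal.ofReal x < expRate γ b) :
    poissonMeasure (n * γ) {k : ℕ | n * b ≤ (k : ℝ)} ≤ ENNReal.ofReal (Real.exp (-(n * x))) := by
  obtain ⟨θ, hθ⟩ := exists_lt_of_lt_expRate h
  have hγ := γ.2
  have h1 := Real.add_one_le_exp θ
  -- Since `exp θ - 1 ≥ θ` and `γ ≤ b`, a negative `θ` would give an exponent at most `θ * (b - γ) ≤
  -- 0 ≤ x`.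
  have hθ0 : 0 ≤ θ := by
    by_contra! hneg
    nlinarith
  rw [← ofReal_measureReal]
  refine ENNReal.ofReal_le_ofReal ((measure_ge_le_exp_cgf (X := fun k : ℕ => (k : ℝ)) (n * b) hθ0
    (integrable_exp_mul_poissonMeasure _ θ)).trans (Real.exp_le_exp.2 ?_))
  rw [cgf_poissonMeasure]
  push_cast
  have : (0 : ℝ) ≤ n := n.cast_nonneg
  nlinarith

lemma poissonMeasure_le_le {n : ℕ} {γ : ℝ≥0} {b x : ℝ} (hx : 0 ≤ x) (hb : b ≤ (γ : ℝ))
    (h : ENNReal.ofReal x < expRate γ b) :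
    poissonMeasure (n * γ) {k : ℕ | (k : ℝ) ≤ n * b} ≤ ENNReal.ofReal (Real.exp (-(n * x))) := by
  obtain ⟨θ, hθ⟩ := exists_lt_of_lt_expRate h
  have hγ := γ.2
  have h1 := Real.add_one_le_exp θ
  have hθ0 : θ ≤ 0 := by
    by_contra! hneg
    nlinarith
  rw [← ofReal_measureReal]
  refine ENNReal.ofReal_le_ofReal ((measure_le_le_exp_cgf (X := fun k : ℕ => (k : ℝ)) (n * b) hθ0
    (integrable_exp_mul_poissonMeasure _ θ)).trans (Real.exp_le_exp.2 ?_))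
  rw [cgf_poissonMeasure]
  push_cast
  have : (0 : ℝ) ≤ n := n.cast_nonneg
  nlinarith

/-- Cut `F` at the mean `γ`. Each part lies beyond its point nearest to `γ`, which belongs to `F` by
closedness, so a one-sided Chernoff bound at that point covers it. The constant `2` does not depend
on `γ`, which the slicing argument needs. -/
lemma poissonMeasure_div_mem_le {n : ℕ} (hn : 0 < n) {γ : ℝ≥0} {F : Set ℝ} (hF : IsClosed F)
    {x : ℝ} (hx : 0 ≤ x) (h : ∀ a ∈ F, ENNReal.ofReal x < expRate γ a) :
    poissonMeasure (n * γ) {k : ℕ | (k : ℝ) / n ∈ F} ≤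
      ENNReal.ofReal (2 * Real.exp (-(n * x))) := by
  have hn' : (0 : ℝ) < n := by exact_mod_cast hn
  have hup : poissonMeasure (n * γ) {k : ℕ | (k : ℝ) / n ∈ F ∩ Ici (γ : ℝ)} ≤
      ENNReal.ofReal (Real.exp (-(n * x))) := by
    rcases (F ∩ Ici (γ : ℝ)).eq_empty_or_nonempty with he | hne
    · simp [he]
    · have hbdd : BddBelow (F ∩ Ici (γ : ℝ)) := ⟨γ, fun y hy => hy.2⟩
      have hmem := (hF.inter isClosed_Ici).csInf_mem hne hbdd
      refine (measure_mono fun k hk => ?_).trans (poissonMeasure_ge_le hx hmem.2 (h _ hmem.1))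
      have := csInf_le hbdd hk
      rw [le_div_iff₀ hn'] at this
      simpa only [mem_ofPred_eq, mul_comm] using this
  have hdown : poissonMeasure (n * γ) {k : ℕ | (k : ℝ) / n ∈ F ∩ Iic (γ : ℝ)} ≤
      ENNReal.ofReal (Real.exp (-(n * x))) := by
    rcases (F ∩ Iic (γ : ℝ)).eq_empty_or_nonempty with he | hne
    · simp [he]
    · have hbdd : BddAbove (F ∩ Iic (γ : ℝ)) := ⟨γ, fun y hy => hy.2⟩
      have hmem := (hF.inter isClosed_Iic).csSup_mem hne hbdd
      refine (measure_mono fun k hk => ?_).trans (poissonMeasure_le_le hx hmem.2 (h _ hmem.1))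
      have := le_csSup hbdd hk
      rw [div_le_iff₀ hn'] at this
      simpa only [mem_ofPred_eq, mul_comm] using this
  rw [two_mul, ENNReal.ofReal_add (Real.exp_nonneg _) (Real.exp_nonneg _)]
  refine (measure_mono fun k hk => ?_).trans ((measure_union_le _ _).trans (add_le_add hup hdown))
  rcases le_total (γ : ℝ) ((k : ℝ) / n) with hle | hle
  · exact Or.inl ⟨hk, hle⟩
  · exact Or.inr ⟨hk, hle⟩

/-! ### Local lower bound for the Poisson distribution -/

/-- The Stirling sequence decreases from its first value `e / √2`, whence `k! ≤ e * √k * (k / e) ^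
k`. -/
lemma log_factorial_le {k : ℕ} (hk : 0 < k) :
    Real.log k.factorial ≤ 1 + Real.log k / 2 + k * Real.log k - k := by
  obtain ⟨m, rfl⟩ := Nat.exists_eq_succ_of_ne_zero hk.ne'
  have h := Stirling.stirlingSeq'_antitone (Nat.zero_le m)
  simp only [Function.comp_apply, Nat.succ_eq_add_one, zero_add, Stirling.stirlingSeq_one] at h ⊢
  rw [Stirling.stirlingSeq] at h
  set K : ℝ := ((m + 1 : ℕ) : ℝ) with hK
  have hK0 : 0 < K := by positivity
  rw [div_le_div_iff₀ (by positivity) (by positivity)] at h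
  have h2 : ((m + 1).factorial : ℝ) ≤ Real.exp 1 * √K * (K / Real.exp 1) ^ (m + 1) := by
    have : (0 : ℝ) < √2 := by positivity
    rw [Real.sqrt_mul (by norm_num)] at h
    refine le_of_mul_le_mul_right ?_ this
    linarith
  refine (Real.log_le_log (by positivity) h2).trans (le_of_eq ?_)
  rw [Real.log_mul (by positivity) (by positivity), Real.log_mul (by positivity) (by positivity),
    Real.log_exp, Real.log_sqrt hK0.le, Real.log_pow, Real.log_div hK0.ne' (by positivity),
    Real.log_exp]
  ring

lemma exp_le_poissonMeasure_singleton {r : ℝ≥0} (hr : 0 < r) {k : ℕ} (hk : 0 < k) :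
    ENNReal.ofReal (Real.exp (-r + k * Real.log r -
      (1 + Real.log k / 2 + k * Real.log k - k))) ≤ poissonMeasure r {k} := by
  have hr' : (0 : ℝ) < r := by exact_mod_cast hr
  rw [poissonMeasure_singleton]
  refine ENNReal.ofReal_le_ofReal ?_
  rw [← Real.le_log_iff_exp_le (by positivity), Real.log_div (by positivity) (by positivity),
    Real.log_mul (by positivity) (by positivity), Real.log_exp, Real.log_pow]
  linarith [log_factorial_le hk]

lemma nonneg_of_expRate_ne_top {γ a : ℝ} (hγ : 0 ≤ γ) (h : expRate γ a ≠ ⊤) : 0 ≤ a := by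
  by_contra! ha
  lift expRate γ a to ℝ≥0 using h with c hc
  -- This slope makes `θ * a = c + 1`; it is negative, so the other term only adds to the excess
  -- over `c`.
  have := le_of_expRate_le hc.ge ((c + 1) / a)
  rw [div_mul_cancel₀ _ ha.ne] at this
  have h1 : (c + 1 : ℝ) / a ≤ 0 := div_nonpos_of_nonneg_of_nonpos (by positivity) ha.le
  have h2 := Real.exp_le_one_iff.2 h1
  nlinarith

lemma eq_zero_of_expRate_zero_ne_top {a : ℝ} (h : expRate 0 a ≠ ⊤) : a = 0 := by
  by_contra! ha
  lift expRate 0 a to ℝ≥0 using h with c hc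
  have := le_of_expRate_le hc.ge ((c + 1) / a)
  rw [div_mul_cancel₀ _ ha] at this
  linarith

lemma ofReal_le_expRate_zero {γ : ℝ} : ENNReal.ofReal γ ≤ expRate γ 0 := by
  refine ENNReal.le_of_forall_nnreal_lt fun c hc => ?_
  have hlim : Tendsto (fun θ : ℝ => θ * 0 - γ * (Real.exp θ - 1)) atBot (𝓝 γ) := by
    simpa using ((Real.tendsto_exp_atBot.sub_const 1).const_mul γ).neg
  have hcγ : (c : ℝ) < γ := by
    rw [← ENNReal.ofReal_coe_nnreal] at hc
    exact (ENNReal.ofReal_lt_ofReal_iff_of_nonneg c.2).1 hc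
  obtain ⟨θ, hθ⟩ := (hlim.eventually_const_lt hcγ).exists
  rw [← ENNReal.ofReal_coe_nnreal]
  exact (ENNReal.ofReal_le_ofReal hθ.le).trans (ofReal_le_expRate γ 0 θ)

lemma ofReal_le_expRate_of_pos {γ a : ℝ} (hγ : 0 < γ) (ha : 0 < a) :
    ENNReal.ofReal (a * Real.log a - a * Real.log γ - a + γ) ≤ expRate γ a := by
  -- `θ = log (a / γ)` is the maximizer in the Legendre transform.
  refine le_trans (ENNReal.ofReal_le_ofReal ?_) (ofReal_le_expRate γ a (Real.log a - Real.log γ))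
  rw [Real.exp_sub, Real.exp_log ha, Real.exp_log hγ, mul_sub, mul_div_cancel₀ _ hγ.ne']
  linarith

lemma tendsto_floor_div {a : ℝ} (ha : 0 ≤ a) :
    Tendsto (fun n : ℕ => (⌊(n : ℝ) * a⌋₊ : ℝ) / n) atTop (𝓝 a) := by
  have := (tendsto_nat_floor_mul_div_atTop ha).comp (tendsto_natCast_atTop_atTop (R := ℝ))
  simpa [Function.comp_def, mul_comm] using this

/-- The point `a = 0`, where the logarithmic formula degenerates, is treated directly: the mass at
`0` is `exp (-(n * γ'))`. -/
lemma eventually_exp_le_poissonMeasure_zero {γ : ℝ≥0} {y : ℝ} (h : expRate γ 0 < ENNReal.ofReal y) :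
    ∃ ε : ℝ, 0 < ε ∧ ∀ n : ℕ, ∀ γ' : ℝ≥0, |(γ' : ℝ) - γ| < ε →
      ENNReal.ofReal (Real.exp (-(n * y))) ≤ poissonMeasure (n * γ') {0} := by
  have hy : (γ : ℝ) < y := ((ENNReal.ofReal_lt_ofReal_iff'.1 (ofReal_le_expRate_zero.trans_lt h))).1
  refine ⟨y - γ, by linarith, fun n γ' hγ' => ?_⟩
  rw [poissonMeasure_singleton]
  refine ENNReal.ofReal_le_ofReal ?_
  have h1 := (abs_lt.1 hγ').2
  have h2 : (0 : ℝ) ≤ n := n.cast_nonneg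
  simp only [NNReal.coe_mul, NNReal.coe_natCast, pow_zero, Nat.factorial_zero, Nat.cast_one,
    mul_one, div_one]
  exact Real.exp_le_exp.2 (by nlinarith)

/-- By Stirling, minus the normalized log-probability of `⌊n * a⌋` is at most the closed-form rate
at `(γ', ⌊n * a⌋ / n)` plus `O(log n / n)`. Continuity of this rate at `(γ, a)` makes the bound
uniform for `γ'` near `γ`. -/
lemma eventually_exp_le_poissonMeasure_floor {γ : ℝ≥0} (hγ : 0 < γ) {a y : ℝ} (ha : 0 < a)
    (h : expRate γ a < ENNReal.ofReal y) :
    ∃ ε : ℝ, 0 < ε ∧ ∀ᶠ n : ℕ in atTop, ∀ γ' : ℝ≥0, |(γ' : ℝ) - γ| < ε →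
      ENNReal.ofReal (Real.exp (-(n * y))) ≤ poissonMeasure (n * γ') {⌊(n : ℝ) * a⌋₊} := by
  have hγ' : (0 : ℝ) < γ := by exact_mod_cast hγ
  have hy := (ENNReal.ofReal_lt_ofReal_iff'.1 ((ofReal_le_expRate_of_pos hγ' ha).trans_lt h)).1
  obtain ⟨y', hy1, hy2⟩ := exists_between hy
  have hcont : ContinuousAt (fun p : ℝ × ℝ =>
      p.2 * Real.log p.2 - p.2 * Real.log p.1 - p.2 + p.1) ((γ : ℝ), a) := by
    have h1 : ContinuousAt (fun p : ℝ × ℝ => Real.log p.2) ((γ : ℝ), a) :=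
      continuousAt_snd.log ha.ne'
    have h2 : ContinuousAt (fun p : ℝ × ℝ => Real.log p.1) ((γ : ℝ), a) :=
      continuousAt_fst.log hγ'.ne'
    fun_prop
  have hev := hcont.eventually_lt_const hy1
  obtain ⟨δ, hδ, hball⟩ := Metric.eventually_nhds_iff.1 hev
  -- The bound by `γ` keeps `γ'` positive, so that its logarithm is usable.
  refine ⟨min δ γ, by positivity, ?_⟩
  have hlog : Tendsto (fun n : ℕ => (1 + Real.log ((n : ℝ) * a) / 2) / n) atTop (𝓝 0) := by
    have h1 : Tendsto (fun x : ℝ => Real.log x / x) atTop (𝓝 0) := by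
      simpa using Real.tendsto_pow_log_div_mul_add_atTop 1 0 1 one_ne_zero
    have h2 := (h1.comp (tendsto_natCast_atTop_atTop (R := ℝ))).div_const 2
    have h3 := tendsto_const_div_atTop_nhds_zero_nat (1 + Real.log a / 2)
    have h4 := h3.add h2
    simp only [zero_div, add_zero] at h4
    refine h4.congr' ?_
    filter_upwards [eventually_gt_atTop 0] with n hn
    have : (n : ℝ) ≠ 0 := by exact_mod_cast hn.ne'
    rw [Real.log_mul this ha.ne']
    simp only [Function.comp_apply]
    ring
  have hfl := tendsto_floor_div ha.le
  filter_upwards [eventually_gt_atTop 0, hlog.eventually_lt_const (sub_pos.2 hy2),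
    hfl.eventually (Metric.ball_mem_nhds a hδ), hfl.eventually_const_lt ha]
    with n hn hlogn hdist hpos g hg
  have hn' : (0 : ℝ) < n := by exact_mod_cast hn
  have hg0 : (0 : ℝ) < g := by
    have := (abs_lt.1 (hg.trans_le (min_le_right _ _))).1
    linarith
  set k := ⌊(n : ℝ) * a⌋₊ with hk
  have hkpos : (0 : ℝ) < k := by
    have := mul_pos hpos hn'
    rwa [div_mul_cancel₀ _ hn'.ne'] at this
  refine le_trans (ENNReal.ofReal_le_ofReal (Real.exp_le_exp.2 ?_))
    (exp_le_poissonMeasure_singleton (r := n * g) (by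
      rw [← NNReal.coe_pos]; push_cast; positivity) (by exact_mod_cast hkpos))
  have hmain : (k / n : ℝ) * Real.log (k / n) - k / n * Real.log g - k / n + g < y' := by
    refine hball (y := ((g : ℝ), (k / n : ℝ))) ?_
    rw [Prod.dist_eq]
    exact max_lt (by simpa [Real.dist_eq] using hg.trans_le (min_le_left _ _)) hdist
  have hkle : (k : ℝ) ≤ n * a := Nat.floor_le (by positivity)
  have hlogk : Real.log k ≤ Real.log (n * a) := Real.log_le_log hkpos hkle
  rw [div_lt_iff₀ hn'] at hlogn
  have hmain' := mul_lt_mul_of_pos_left hmain hn'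
  rw [Real.log_div hkpos.ne' hn'.ne'] at hmain'
  push_cast
  rw [Real.log_mul hn'.ne' hg0.ne']
  have e1 : n * ((k / n : ℝ) * (Real.log k - Real.log n) - k / n * Real.log g - k / n + g) =
      k * (Real.log k - Real.log n) - k * Real.log g - k + n * g := by
    field_simp
  rw [e1] at hmain'
  linarith

/-- The Poisson distributions satisfy the lower bound locally uniformly in the parameter. -/
lemma eventually_exp_le_poissonMeasure {γ : ℝ≥0} {G : Set ℝ} (hG : IsOpen G) {a y : ℝ}
    (ha : a ∈ G) (h : expRate γ a < ENNReal.ofReal y) :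
    ∃ ε : ℝ, 0 < ε ∧ ∀ᶠ n : ℕ in atTop, ∀ γ' : ℝ≥0, |(γ' : ℝ) - γ| < ε →
      ENNReal.ofReal (Real.exp (-(n * y))) ≤ poissonMeasure (n * γ') {k : ℕ | (k : ℝ) / n ∈ G} := by
  have ha0 : 0 ≤ a := nonneg_of_expRate_ne_top γ.2 h.ne_top
  rcases ha0.eq_or_lt with rfl | hapos
  · obtain ⟨ε, hε, hn⟩ := eventually_exp_le_poissonMeasure_zero h
    refine ⟨ε, hε, Eventually.of_forall fun n γ' hγ' => (hn n γ' hγ').trans (measure_mono ?_)⟩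
    simpa using ha
  · have hγ : 0 < γ := by
      refine pos_iff_ne_zero.2 fun h0 => hapos.ne' (eq_zero_of_expRate_zero_ne_top ?_)
      subst h0
      exact h.ne_top
    obtain ⟨ε, hε, hev⟩ := eventually_exp_le_poissonMeasure_floor hγ hapos h
    refine ⟨ε, hε, ?_⟩
    filter_upwards [hev, (tendsto_floor_div ha0).eventually (hG.mem_nhds ha)] with n hn hmem γ' hγ'
    refine (hn γ' hγ').trans (measure_mono ?_)
    exact singleton_subset_iff.2 hmem

section

/-! ### Large deviations of mixed Poisson distributions -/

/-- The LDP lower bound gives each ball around `γ` mass at least `exp (-n * (ψ γ + 1))` eventually,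
hence positive mass. A negative `γ` is excluded by a ball inside the null half-line. -/
lemma mem_attainable_of_ne_top {ν : ℕ → Measure ℝ} {ψ : ℝ → ℝ≥0∞} (hν : ∀ n, ν n (Iio 0) = 0)
    (h : SatisfiesLDP ν ψ) {γ : ℝ} (hγ : ψ γ ≠ ⊤) :
    ∃ γ' ∈ attainable ν, (γ' : ℝ) = γ := by
  have key : ∀ ε : ℝ, 0 < ε → ∃ N : ℕ, ∀ n ≥ N, 0 < ν n (Metric.ball γ ε) := by
    intro ε hε
    have hlt : (⨅ a ∈ Metric.ball γ ε, ψ a) < ((ψ γ).toNNReal + 1 : ℝ≥0) := by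
      refine (iInf₂_le γ (Metric.mem_ball_self hε)).trans_lt ?_
      rw [ENNReal.coe_add, ENNReal.coe_toNNReal hγ]
      exact ENNReal.lt_add_right hγ (by simp)
    obtain ⟨N, hN⟩ := eventually_atTop.1
      (eventually_exp_le_of_le_liminf (h.lower_bound _ Metric.isOpen_ball) hlt)
    exact ⟨N, fun n hn => (ENNReal.ofReal_pos.2 (Real.exp_pos _)).trans_le (hN n hn)⟩
  have h0 : 0 ≤ γ := by
    by_contra! hneg
    obtain ⟨N, hN⟩ := key (-γ) (by linarith)
    refine (hN N le_rfl).ne' (measure_mono_null (fun x hx => ?_) (hν N))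
    have := (abs_lt.1 (Metric.mem_ball.1 hx)).2
    exact show x < 0 by linarith
  exact ⟨⟨γ, h0⟩, key, rfl⟩

/-- Parameters that are not attainable have `ψ = ⊤` and do not affect the infimum. -/
lemma mixedRate_eq_iInf {ν : ℕ → Measure ℝ} {ψ : ℝ → ℝ≥0∞} (hν : ∀ n, ν n (Iio 0) = 0)
    (h : SatisfiesLDP ν ψ) (a : ℝ) :
    mixedRate ν ψ a = ⨅ γ : ℝ, (expRate γ a + ψ γ) := by
  refine le_antisymm (le_iInf fun γ => ?_) (le_iInf₂ fun γ _ => ?_)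
  · rcases eq_or_ne (ψ γ) ⊤ with ht | ht
    · simp [ht]
    · obtain ⟨γ', hγ', rfl⟩ := mem_attainable_of_ne_top hν h ht
      rw [← poissonRate_eq_expRate]
      exact iInf₂_le γ' hγ'
  · rw [poissonRate_eq_expRate]
    exact iInf_le _ (γ : ℝ)

section Mixture

variable {D : Type*} [MeasurableSpace D] {π : Measure D} {Φ : D → ℝ≥0} {F : Set ℝ}

/-- Splitting according to the cost of reaching `F` from the random parameter. -/
lemma lintegral_poissonMeasure_le_sum [IsProbabilityMeasure π] (hΦ : Measurable Φ)
    (hF : IsClosed F) {n : ℕ} (hn : 0 < n) (d : ℝ≥0) (k : ℕ) :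
    ∫⁻ ω, poissonMeasure (n * Φ ω) {j : ℕ | (j : ℝ) / n ∈ F} ∂π ≤
      (∑ i ∈ Finset.range (k + 1), ENNReal.ofReal (2 * Real.exp (-(n * ((i - 1 : ℝ) * d)))) *
        π.map (fun ω => (Φ ω : ℝ)) {γ : ℝ | ∃ a ∈ F, expRate γ a ≤ ((i * d : ℝ≥0) : ℝ≥0∞)}) +
      ENNReal.ofReal (2 * Real.exp (-(n * (k * d)))) := by
  classical
  have hΦ' : Measurable (fun ω => (Φ ω : ℝ)) := by fun_prop
  set C : ℕ → Set ℝ := fun i => {γ : ℝ | ∃ a ∈ F, expRate γ a ≤ ((i * d : ℝ≥0) : ℝ≥0∞)} with hC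
  have hCm : ∀ i, MeasurableSet ((fun ω => (Φ ω : ℝ)) ⁻¹' C i) := fun i =>
    hΦ' (isClosed_setOf_exists_expRate_le hF _).measurableSet
  have hpt : ∀ ω, poissonMeasure (n * Φ ω) {j : ℕ | (j : ℝ) / n ∈ F} ≤
      (∑ i ∈ Finset.range (k + 1), ((fun ω => (Φ ω : ℝ)) ⁻¹' C i).indicator
        (fun _ => ENNReal.ofReal (2 * Real.exp (-(n * ((i - 1 : ℝ) * d))))) ω) +
      ENNReal.ofReal (2 * Real.exp (-(n * (k * d)))) := by
    intro ω
    have hout : ∀ i : ℕ, (Φ ω : ℝ) ∉ C i →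
        poissonMeasure (n * Φ ω) {j : ℕ | (j : ℝ) / n ∈ F} ≤
          ENNReal.ofReal (2 * Real.exp (-(n * (i * d)))) := by
      intro i hi
      refine poissonMeasure_div_mem_le hn hF (by positivity) fun a ha => ?_
      by_contra! hle
      refine hi ⟨a, ha, hle.trans ?_⟩
      rw [← ENNReal.ofReal_coe_nnreal]
      push_cast
      exact le_rfl
    -- With `i` the least such index, the parameter lies outside `C (i - 1)`, so Chernoff applies at
    -- rate `(i - 1) * d`. For `i = 0` the claimed bound exceeds `1`.
    by_cases hex : ∃ i, i ≤ k ∧ (Φ ω : ℝ) ∈ C i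
    · have hmin := Nat.find_spec hex
      set i := Nat.find hex with hi
      refine le_trans ?_ (le_add_of_nonneg_right zero_le)
      refine le_trans ?_ (Finset.single_le_sum (fun _ _ => zero_le)
        (Finset.mem_range.2 (Nat.lt_succ_of_le hmin.1)))
      rw [indicator_of_mem (show ω ∈ (fun ω => (Φ ω : ℝ)) ⁻¹' C i from hmin.2)]
      rcases Nat.eq_zero_or_pos i with h0 | hpos
      · refine prob_le_one.trans ?_
        rw [← ENNReal.ofReal_one, h0]
        refine ENNReal.ofReal_le_ofReal ?_
        have : (0 : ℝ) ≤ n * d := by positivity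
        have := Real.one_le_exp this
        simp only [CharP.cast_eq_zero, zero_sub, neg_mul, one_mul, mul_neg, neg_neg]
        linarith
      · have hnot : (Φ ω : ℝ) ∉ C (i - 1) := fun hmem =>
          Nat.find_min hex (m := i - 1) (by omega) ⟨by omega, hmem⟩
        have := hout (i - 1) hnot
        rwa [Nat.cast_sub hpos, Nat.cast_one] at this
    · push Not at hex
      exact (hout k (hex k le_rfl)).trans (le_add_of_nonneg_left zero_le)
  refine (lintegral_mono hpt).trans (le_of_eq ?_)
  rw [lintegral_add_right _ measurable_const, lintegral_finsetSum _
    fun i _ => measurable_const.indicator (hCm i)]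
  simp only [lintegral_const, measure_univ, mul_one]
  congr 1
  refine Finset.sum_congr rfl fun i _ => ?_
  rw [lintegral_indicator_const (hCm i), Measure.map_apply hΦ'
    (isClosed_setOf_exists_expRate_le hF _).measurableSet]

end Mixture

variable {D : ℕ → Type*} [∀ n, MeasurableSpace (D n)] {π : ∀ n, Measure (D n)} {Φ : ∀ n, D n → ℝ≥0}
  {ψ : ℝ → ℝ≥0∞}

/-- On `C i` one has `ψ ≥ m - i * d`, so its mass decays at rate `m - (i + 1) * d`, one `d` being
lost to strictness. Chernoff contributes `(i - 1) * d`, so every slice has total rate at least `m -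
2 * d`. -/
lemma eventually_mixture_le [∀ n, IsProbabilityMeasure (π n)] (hΦ : ∀ n, Measurable (Φ n))
    (h : SatisfiesLDP (fun n => (π n).map (fun ω => (Φ n ω : ℝ))) ψ) {F : Set ℝ}
    (hF : IsClosed F) {x : ℝ≥0} (hx : (x : ℝ≥0∞) < ⨅ a ∈ F, ⨅ γ : ℝ, (expRate γ a + ψ γ)) :
    ∃ C : ℝ, 0 < C ∧ ∀ᶠ n : ℕ in atTop,
      ∫⁻ ω, poissonMeasure (n * Φ n ω) {j : ℕ | (j : ℝ) / n ∈ F} ∂(π n) ≤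
        ENNReal.ofReal (C * Real.exp (-(n * (x : ℝ)))) := by
  obtain ⟨m, hxm, hm⟩ := ENNReal.lt_iff_exists_nnreal_btwn.1 hx
  have hxm' : (x : ℝ) < m := by exact_mod_cast hxm
  -- This makes `2 * d ≤ m - x` for `d = m / k`, and the remainder beyond level `k` has rate `k * d
  -- = m`.
  obtain ⟨k, hk⟩ := exists_nat_gt (2 * m / (m - x) : ℝ)
  have hm0 : (0 : ℝ) < m := lt_of_le_of_lt x.2 hxm'
  have hk0 : (0 : ℝ) < k := lt_of_le_of_lt (div_nonneg (by positivity) (by linarith)) hk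
  rw [div_lt_iff₀ (by linarith)] at hk
  set d : ℝ≥0 := m / k with hd
  have hkd : (k : ℝ) * d = m := by
    rw [hd]; push_cast; field_simp
  have hd0 : (0 : ℝ) < d := by rw [hd]; push_cast; positivity
  have hxd : (x : ℝ) ≤ m - 2 * d := by
    have : k * (x : ℝ) ≤ k * (m - 2 * d) := by nlinarith
    exact le_of_mul_le_mul_left this hk0
  set C : ℕ → Set ℝ := fun i => {γ : ℝ | ∃ a ∈ F, expRate γ a ≤ ((i * d : ℝ≥0) : ℝ≥0∞)} with hC
  have hν : ∀ i ∈ Finset.range (k + 1), ∀ᶠ n : ℕ in atTop,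
      (π n).map (fun ω => (Φ n ω : ℝ)) (C i) ≤
        ENNReal.ofReal (Real.exp (-(n * (m - (i + 1) * d)))) := by
    intro i _
    rcases le_or_gt 0 ((m : ℝ) - (i + 1) * d) with h0 | h0
    · obtain ⟨y, hy⟩ : ∃ y : ℝ≥0, (y : ℝ) = m - (i + 1) * d := ⟨⟨_, h0⟩, rfl⟩
      have hlt : (y : ℝ≥0∞) < ⨅ γ ∈ C i, ψ γ := by
        have hyd : (y : ℝ≥0∞) < (y + d : ℝ≥0) := by
          rw [ENNReal.coe_lt_coe, ← NNReal.coe_lt_coe]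
          push_cast
          linarith
        refine hyd.trans_le (le_iInf₂ fun γ hγ => ?_)
        obtain ⟨a, ha, hle⟩ := hγ
        have h1 : (m : ℝ≥0∞) ≤ ((i * d : ℝ≥0) : ℝ≥0∞) + ψ γ :=
          hm.le.trans ((iInf₂_le a ha).trans ((iInf_le _ γ).trans (by gcongr)))
        have h2 : (m : ℝ≥0∞) = ((i * d : ℝ≥0) : ℝ≥0∞) + ((y + d : ℝ≥0) : ℝ≥0∞) := by
          rw [← ENNReal.coe_add, ENNReal.coe_inj, ← NNReal.coe_inj]
          push_cast
          rw [hy]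
          ring
        rw [h2] at h1
        exact (ENNReal.add_le_add_iff_left ENNReal.coe_ne_top).1 h1
      have := eventually_le_exp_of_limsup_le
        (h.upper_bound _ (isClosed_setOf_exists_expRate_le hF (i * d))) hlt
      rwa [hy] at this
    · refine Eventually.of_forall fun n => ?_
      have : IsProbabilityMeasure ((π n).map (fun ω => (Φ n ω : ℝ))) :=
        Measure.isProbabilityMeasure_map (by have := hΦ n; fun_prop)
      refine prob_le_one.trans ?_
      rw [← ENNReal.ofReal_one]
      refine ENNReal.ofReal_le_ofReal (Real.one_le_exp ?_)
      have : (0 : ℝ) ≤ n := n.cast_nonneg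
      nlinarith
  -- There are `k + 1` slices and one remainder, each with prefactor `2`.
  refine ⟨2 * (k + 2), by positivity, ?_⟩
  filter_upwards [(Finset.eventually_all _).2 hν, eventually_gt_atTop 0] with n hn hn0
  refine (lintegral_poissonMeasure_le_sum (hΦ n) hF hn0 d k).trans ?_
  have hnn : (0 : ℝ) ≤ n := n.cast_nonneg
  calc _ ≤ (∑ i ∈ Finset.range (k + 1), ENNReal.ofReal (2 * Real.exp (-(n * (x : ℝ))))) +
        ENNReal.ofReal (2 * Real.exp (-(n * (x : ℝ)))) := by
        refine add_le_add (Finset.sum_le_sum fun i hi => ?_) ?_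
        · refine (mul_le_mul_right (hn i hi) _).trans ?_
          rw [← ENNReal.ofReal_mul (by positivity), mul_assoc, ← Real.exp_add]
          refine ENNReal.ofReal_le_ofReal
            (mul_le_mul_of_nonneg_left (Real.exp_le_exp.2 ?_) (by norm_num))
          nlinarith
        · refine ENNReal.ofReal_le_ofReal
            (mul_le_mul_of_nonneg_left (Real.exp_le_exp.2 ?_) (by norm_num))
          nlinarith
    _ = _ := by
        rw [Finset.sum_const, Finset.card_range, nsmul_eq_mul, ← ENNReal.ofReal_natCast,
          ← ENNReal.ofReal_mul (by positivity), ← ENNReal.ofReal_add (by positivity)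
          (by positivity)]
        congr 1
        push_cast
        ring

/-- The budget `x` is split into `w > ψ γ`, spent on putting the parameter near `γ`, and `x - w >
expRate γ a`, spent on the Poisson variable uniformly over that ball. -/
lemma eventually_le_mixture (hΦ : ∀ n, Measurable (Φ n))
    (h : SatisfiesLDP (fun n => (π n).map (fun ω => (Φ n ω : ℝ))) ψ) {G : Set ℝ}
    (hG : IsOpen G) {x : ℝ≥0} {a : ℝ} (ha : a ∈ G) {γ : ℝ≥0}
    (hx : expRate γ a + ψ γ < x) :
    ∀ᶠ n : ℕ in atTop, ENNReal.ofReal (Real.exp (-(n * (x : ℝ)))) ≤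
      ∫⁻ ω, poissonMeasure (n * Φ n ω) {j : ℕ | (j : ℝ) / n ∈ G} ∂(π n) := by
  have hne : expRate γ a ≠ ⊤ := (le_self_add.trans_lt hx).ne_top
  have hψx : ψ γ < x - expRate γ a := lt_tsub_iff_right.2 (by rwa [add_comm])
  obtain ⟨w, hw1, hw2⟩ := ENNReal.lt_iff_exists_nnreal_btwn.1 hψx
  have hLx : expRate γ a < x - w :=
    lt_tsub_iff_right.2 (by rw [add_comm]; exact lt_tsub_iff_right.1 hw2)
  have hwx : w ≤ x := by
    by_contra! hlt
    rw [tsub_eq_zero_of_le (ENNReal.coe_le_coe.2 hlt.le)] at hLx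
    exact not_lt_zero hLx
  have hLx' : expRate γ a < ENNReal.ofReal (x - w) := by
    rwa [← ENNReal.coe_sub, ← ENNReal.ofReal_coe_nnreal, NNReal.coe_sub hwx] at hLx
  obtain ⟨ε, hε, hev⟩ := eventually_exp_le_poissonMeasure hG ha hLx'
  have hball : (⨅ b ∈ Metric.ball (γ : ℝ) ε, ψ b) < w :=
    (iInf₂_le _ (Metric.mem_ball_self hε)).trans_lt hw1
  filter_upwards [hev, eventually_exp_le_of_le_liminf (h.lower_bound _ Metric.isOpen_ball) hball]
    with n hn hνn
  have hΦ' : Measurable (fun ω => (Φ n ω : ℝ)) := by have := hΦ n; fun_prop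
  rw [Measure.map_apply hΦ' Metric.isOpen_ball.measurableSet] at hνn
  have hsplit : -(n * (x : ℝ)) = -(n * ((x : ℝ) - w)) + -(n * (w : ℝ)) := by ring
  rw [hsplit, Real.exp_add, ENNReal.ofReal_mul (Real.exp_nonneg _)]
  refine (mul_le_mul_right hνn _).trans ?_
  rw [← lintegral_indicator_const (hΦ' Metric.isOpen_ball.measurableSet)]
  refine lintegral_mono fun ω => ?_
  by_cases hω : ω ∈ (fun ω => (Φ n ω : ℝ)) ⁻¹' Metric.ball (γ : ℝ) ε
  · rw [indicator_of_mem hω]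
    exact hn _ hω
  · rw [indicator_of_notMem hω]
    exact zero_le

/-- If the parameters satisfy a large deviations principle, not necessarily with a good rate
function, then so do the scaled mixed Poisson variables. -/
theorem satisfiesLDP_mixedPoisson [∀ n, IsProbabilityMeasure (π n)]
    (hΦ : ∀ n, Measurable (Φ n))
    (h : SatisfiesLDP (fun n => (π n).map (fun ω => (Φ n ω : ℝ))) ψ) {Q : ℕ → Measure ℝ}
    (hQ : ∀ n, 0 < n → ∀ A, MeasurableSet A →
      Q n A = ∫⁻ ω, poissonMeasure (n * Φ n ω) {j : ℕ | (j : ℝ) / n ∈ A} ∂(π n))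
    (hQ1 : ∀ n, IsProbabilityMeasure (Q n)) :
    SatisfiesLDP Q (mixedRate (fun n => (π n).map (fun ω => (Φ n ω : ℝ))) ψ) := by
  have hν : ∀ n, (π n).map (fun ω => (Φ n ω : ℝ)) (Iio 0) = 0 := by
    intro n
    rw [Measure.map_apply (by have := hΦ n; fun_prop) measurableSet_Iio]
    have : (fun ω => (Φ n ω : ℝ)) ⁻¹' Iio 0 = ∅ := by
      ext ω; simp
    rw [this, measure_empty]
  have hrate : mixedRate (fun n => (π n).map (fun ω => (Φ n ω : ℝ))) ψ =
      fun a => ⨅ γ : ℝ, (expRate γ a + ψ γ) := funext (mixedRate_eq_iInf hν h)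
  refine ⟨?_, fun F hF => ?_, fun G hG => ?_⟩
  · rw [hrate]
    exact lowerSemicontinuous_iInf_expRate_add h.lowerSemicontinuous
  · refine limsup_le_of_eventually_le_mul_exp (fun n => prob_le_one) fun x hx => ?_
    rw [hrate] at hx
    obtain ⟨C, hC, hev⟩ := eventually_mixture_le hΦ h hF hx
    refine ⟨C, hC, ?_⟩
    filter_upwards [hev, eventually_gt_atTop 0] with n hn hn0
    rwa [hQ n hn0 F hF.measurableSet]
  · refine le_liminf_of_eventually_exp_le fun x hx => ?_
    obtain ⟨a, hax⟩ := iInf_lt_iff.1 hx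
    obtain ⟨ha, hax⟩ := iInf_lt_iff.1 hax
    obtain ⟨γ, hγ⟩ := iInf_lt_iff.1 hax
    obtain ⟨-, hγ⟩ := iInf_lt_iff.1 hγ
    rw [poissonRate_eq_expRate] at hγ
    filter_upwards [eventually_le_mixture hΦ h hG ha hγ, eventually_gt_atTop 0] with n hn hn0
    rwa [hQ n hn0 G hG.measurableSet]

end

/-! ### Change of variables along the primitive of a nonnegative function -/

section Primitive

variable {w : ℝ → ℝ} {a b : ℝ}

lemma monotone_primitive (h0 : ∀ x, 0 ≤ w x) (hi : ∀ u v, IntervalIntegrable w volume u v)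
    (a : ℝ) :
    Monotone (fun s => ∫ r in a..s, w r) := by
  intro s s' hs
  have := intervalIntegral.integral_add_adjacent_intervals (hi a s) (hi s s')
  have h2 := intervalIntegral.integral_nonneg (μ := volume) hs (fun u _ => h0 u)
  show _ ≤ _
  linarith

lemma continuous_primitive' (hi : ∀ u v, IntervalIntegrable w volume u v) (a : ℝ) :
    Continuous (fun s => ∫ r in a..s, w r) :=
  intervalIntegral.continuous_primitive hi a

lemma setLIntegral_Ioc_ofReal (h0 : ∀ x, 0 ≤ w x) (hi : IntervalIntegrable w volume a b)
    (hab : a ≤ b) :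
    ∫⁻ s in Ioc a b, ENNReal.ofReal (w s) = ENNReal.ofReal (∫ r in a..b, w r) := by
  rw [intervalIntegral.integral_of_le hab, ofReal_integral_eq_lintegral_ofReal hi.1
    (Eventually.of_forall h0)]

/-- The primitive need not be injective, but its flat pieces carry no mass. On half-lines, the
preimage of `Iic u` in `Ioc a b` is an interval `Ioc a c`, whose mass is the value of the primitive
at `c`, namely `min u (Λ b)` by the intermediate value theorem. -/
lemma map_primitive_withDensity (h0 : ∀ x, 0 ≤ w x)
    (hi : ∀ u v, IntervalIntegrable w volume u v) (hab : a ≤ b) :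
    ((volume.restrict (Ioc a b)).withDensity (fun s => ENNReal.ofReal (w s))).map
      (fun s => ∫ r in a..s, w r) = volume.restrict (Ioc 0 (∫ r in a..b, w r)) := by
  set Λ : ℝ → ℝ := fun s => ∫ r in a..s, w r with hΛ
  have hmono : Monotone Λ := monotone_primitive h0 hi a
  have hcont : Continuous Λ := continuous_primitive' hi a
  have hΛa : Λ a = 0 := by simp [hΛ]
  have hfin : IsFiniteMeasure
      ((volume.restrict (Ioc a b)).withDensity (fun s => ENNReal.ofReal (w s))) := by
    refine isFiniteMeasure_withDensity ?_
    rw [setLIntegral_Ioc_ofReal h0 (hi a b) hab]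
    exact ENNReal.ofReal_ne_top
  refine Measure.ext_of_Iic _ _ fun u => ?_
  rw [Measure.map_apply hcont.measurable measurableSet_Iic,
    withDensity_apply _ (hcont.measurable measurableSet_Iic),
    Measure.restrict_restrict (hcont.measurable measurableSet_Iic),
    Measure.restrict_apply measurableSet_Iic]
  have hR : Iic u ∩ Ioc 0 (Λ b) = Ioc 0 (min u (Λ b)) := by
    ext x
    simp only [mem_inter_iff, mem_Iic, mem_Ioc, le_min_iff]
    tauto
  rw [hR, Real.volume_Ioc, sub_zero]
  rcases lt_or_ge u 0 with hu | hu
  · have : Λ ⁻¹' Iic u ∩ Ioc a b = ∅ := by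
      ext s
      simp only [mem_inter_iff, mem_preimage, mem_Iic, mem_Ioc, mem_empty_iff_false, iff_false,
        not_and]
      intro h1 h2
      have := hmono h2.le
      rw [hΛa] at this
      linarith
    rw [this, ENNReal.ofReal_of_nonpos ((min_le_left _ _).trans hu.le)]
    simp
  · set S : Set ℝ := Icc a b ∩ Λ ⁻¹' Iic u with hS
    have hSc : IsCompact S := isCompact_Icc.inter_right (isClosed_Iic.preimage hcont)
    have haS : a ∈ S := ⟨left_mem_Icc.2 hab, by simpa [hΛa] using hu⟩
    obtain ⟨hcI, hcu⟩ := hSc.sSup_mem ⟨a, haS⟩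
    set c := sSup S with hc
    have hcS : ∀ s ∈ S, s ≤ c := fun s hs => le_csSup hSc.bddAbove hs
    have hΛc : Λ c = min u (Λ b) := by
      refine le_antisymm (le_min hcu (hmono hcI.2)) ?_
      obtain ⟨c', hc', hc'2⟩ := intermediate_value_Icc hab hcont.continuousOn
        (show min u (Λ b) ∈ Icc (Λ a) (Λ b) from
          ⟨by rw [hΛa]; exact le_min hu (hΛa ▸ hmono hab), min_le_right _ _⟩)
      rw [← hc'2]
      exact hmono (hcS c' ⟨hc', by rw [mem_preimage, hc'2]; exact mem_Iic.2 (min_le_left _ _)⟩)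
    have hset : Λ ⁻¹' Iic u ∩ Ioc a b = Ioc a c := by
      ext s
      constructor
      · rintro ⟨h1, h2⟩
        exact ⟨h2.1, hcS s ⟨⟨h2.1.le, h2.2⟩, h1⟩⟩
      · rintro ⟨h1, h2⟩
        exact ⟨(hmono h2).trans hcu, h1, h2.trans hcI.2⟩
    rw [hset, setLIntegral_Ioc_ofReal h0 (hi a c) hcI.1, ← hΛc]

lemma lintegral_comp_primitive (hw : Measurable w) (h0 : ∀ x, 0 ≤ w x)
    (hi : ∀ u v, IntervalIntegrable w volume u v) (hab : a ≤ b) {g : ℝ → ℝ≥0∞}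
    (hg : Measurable g) :
    ∫⁻ s in Ioc a b, ENNReal.ofReal (w s) * g (∫ r in a..s, w r) =
      ∫⁻ y in Ioc 0 (∫ r in a..b, w r), g y := by
  have hc := (continuous_primitive' hi a).measurable
  rw [← map_primitive_withDensity h0 hi hab, lintegral_map hg hc]
  exact (lintegral_withDensity_eq_lintegral_mul _ (by fun_prop) (hg.comp hc)).symm

/-- Almost every point, for the density `w`, is the first point where its value of the primitive
is reached. -/
lemma ae_primitive_lt (hw : Measurable w) (h0 : ∀ x, 0 ≤ w x)
    (hi : ∀ u v, IntervalIntegrable w volume u v) (hab : a ≤ b) :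
    ∀ᵐ s ∂(volume.restrict (Ioc a b)), w s ≠ 0 →
      ∀ s' < s, ∫ r in a..s', w r < ∫ r in a..s, w r := by
  set Λ : ℝ → ℝ := fun s => ∫ r in a..s, w r with hΛ
  have hmono : Monotone Λ := monotone_primitive h0 hi a
  have hc : Measurable Λ := (continuous_primitive' hi a).measurable
  -- A level at which `Λ` is constant on an interval is its value at some rational. These levels are
  -- countable, hence null for Lebesgue measure, the image of `w ds`.
  have hcount : (range (fun q : ℚ => Λ q)).Countable := countable_range _
  have hnull : ((volume.restrict (Ioc a b)).withDensity (fun s => ENNReal.ofReal (w s)))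
      (Λ ⁻¹' range (fun q : ℚ => Λ q)) = 0 := by
    rw [← Measure.map_apply hc hcount.measurableSet, map_primitive_withDensity h0 hi hab]
    exact hcount.measure_zero _
  have hae := (ae_withDensity_iff (μ := volume.restrict (Ioc a b)) (by fun_prop)).1
    (measure_eq_zero_iff_ae_notMem.1 hnull)
  filter_upwards [hae] with s hs hws s' hs'
  have hnot := hs (by simpa using lt_of_le_of_ne (h0 s) hws.symm)
  refine lt_of_le_of_ne (hmono hs'.le) fun heq => hnot ?_
  obtain ⟨q, hq1, hq2⟩ := exists_rat_btwn hs'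
  exact ⟨q, le_antisymm (hmono hq2.le) (heq.symm.le.trans (hmono hq1.le))⟩

end Primitive

/-! ### Sequences of independent exponential variables -/

instance isProbabilityMeasure_expMeasure_one : IsProbabilityMeasure (expMeasure 1) :=
  isProbabilityMeasure_expMeasure one_pos

/-- The law of a sequence of independent standard exponential variables. -/
noncomputable def expSeq : Measure (ℕ → ℝ) := Measure.infinitePi (fun _ => expMeasure 1)

instance : IsProbabilityMeasure expSeq := by unfold expSeq; infer_instance

/-- Prepend a term to a sequence. -/
def consSeq (a : ℝ) (s : ℕ → ℝ) : ℕ → ℝ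
  | 0 => a
  | k + 1 => s k

lemma measurable_consSeq : Measurable (fun p : ℝ × (ℕ → ℝ) => consSeq p.1 p.2) := by
  refine measurable_pi_iff.2 fun k => ?_
  cases k with
  | zero => exact measurable_fst
  | succ k => exact (measurable_pi_apply k).comp measurable_snd

/-- This is the renewal step: it allows conditioning on the first interarrival time or mark, the
rest being an independent copy. -/
lemma map_consSeq : ((expMeasure 1).prod expSeq).map (fun p => consSeq p.1 p.2) = expSeq := by
  refine Measure.eq_infinitePi _ fun s t ht => ?_
  rw [Measure.map_apply measurable_consSeq (.pi s.countable_toSet fun _ _ => ht _)]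
  classical
  set s' : Finset ℕ := s.preimage Nat.succ Nat.succ_injective.injOn with hs'
  have hpre : (fun p : ℝ × (ℕ → ℝ) => consSeq p.1 p.2) ⁻¹' ((s : Set ℕ).pi t) =
      (if 0 ∈ s then t 0 else univ) ×ˢ ((s' : Set ℕ).pi fun k => t (k + 1)) := by
    ext ⟨a, x⟩
    simp only [mem_preimage, Set.mem_pi, Finset.mem_coe, mem_prod, hs', Finset.mem_preimage]
    constructor
    · intro h
      refine ⟨?_, fun k hk => h (k + 1) hk⟩
      split_ifs with h0
      · exact h 0 h0
      · trivial
    · rintro ⟨h1, h2⟩ k hk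
      cases k with
      | zero => rw [if_pos hk] at h1; exact h1
      | succ k => exact h2 k hk
  rw [hpre, Measure.prod_prod, expSeq, Measure.infinitePi_pi _ fun k _ => ht (k + 1)]
  have himg : s.erase 0 = s'.image Nat.succ := by
    ext k
    simp only [Finset.mem_erase, Finset.mem_image, hs', Finset.mem_preimage]
    constructor
    · rintro ⟨h1, h2⟩
      obtain ⟨m, rfl⟩ := Nat.exists_eq_succ_of_ne_zero h1
      exact ⟨m, h2, rfl⟩
    · rintro ⟨m, hm, rfl⟩
      exact ⟨Nat.succ_ne_zero m, hm⟩
  have hprod : ∏ i ∈ s.erase 0, expMeasure 1 (t i) = ∏ i ∈ s', expMeasure 1 (t (i + 1)) := by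
    rw [himg, Finset.prod_image Nat.succ_injective.injOn]
  rw [← hprod]
  by_cases h0 : 0 ∈ s
  · rw [if_pos h0, Finset.mul_prod_erase s (fun i => expMeasure 1 (t i)) h0]
  · rw [if_neg h0, measure_univ, one_mul, Finset.erase_eq_of_notMem h0]

lemma lintegral_expSeq_cons {F : (ℕ → ℝ) → ℝ≥0∞} (hF : Measurable F) :
    ∫⁻ s, F s ∂expSeq = ∫⁻ a, ∫⁻ s, F (consSeq a s) ∂expSeq ∂(expMeasure 1) := by
  conv_lhs => rw [← map_consSeq]
  rw [lintegral_map hF measurable_consSeq]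
  exact lintegral_prod _ (hF.comp measurable_consSeq).aemeasurable

lemma lintegral_expMeasure_one {g : ℝ → ℝ≥0∞} (hg : Measurable g) :
    ∫⁻ x, g x ∂(expMeasure 1) = ∫⁻ x in Ioi 0, ENNReal.ofReal (Real.exp (-x)) * g x := by
  have hd : expMeasure 1 = volume.withDensity (exponentialPDF 1) := rfl
  have hm : Measurable (exponentialPDF 1) := (measurable_exponentialPDFReal 1).ennreal_ofReal
  rw [hd, lintegral_withDensity_eq_lintegral_mul _ hm hg, ← setLIntegral_congr Ioi_ae_eq_Ici.symm,
    ← lintegral_indicator measurableSet_Ici]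
  refine lintegral_congr fun x => ?_
  by_cases hx : 0 ≤ x
  · rw [indicator_of_mem (mem_Ici.2 hx), Pi.mul_apply, exponentialPDF_of_nonneg hx]
    simp
  · rw [indicator_of_notMem (by simpa using hx), Pi.mul_apply,
      exponentialPDF_of_neg (not_le.1 hx), zero_mul]

lemma expMeasure_one_Ioi {x : ℝ} (hx : 0 ≤ x) :
    expMeasure 1 (Ioi x) = ENNReal.ofReal (Real.exp (-x)) := by
  have h := cdf_expMeasure_eq one_pos x
  rw [if_pos hx, cdf_eq_real, one_mul] at h
  have hc : (Iic x)ᶜ = Ioi x := compl_Iic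
  rw [← ofReal_measureReal, ← hc, probReal_compl_eq_one_sub measurableSet_Iic, h]
  congr 1
  ring

lemma ae_expSeq_nonneg : ∀ᵐ s ∂expSeq, ∀ k, 0 ≤ s k := by
  refine ae_all_iff.2 fun k => ?_
  have hk : MeasurePreserving (Function.eval k) expSeq (expMeasure 1) :=
    measurePreserving_eval_infinitePi _ k
  refine hk.quasiMeasurePreserving.ae (p := fun x => 0 ≤ x) ?_
  rw [ae_iff]
  have hset : {x : ℝ | ¬ 0 ≤ x} ⊆ (Ioi 0)ᶜ := fun x hx => by
    simp only [mem_compl_iff, mem_Ioi, not_lt]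
    exact (not_le.1 hx).le
  refine measure_mono_null hset ?_
  rw [prob_compl_eq_zero_iff measurableSet_Ioi, expMeasure_one_Ioi le_rfl]
  simp

/-- Guarantees that the renewal path passes `L`: all of the first `n` terms stay below `L` with
probability at most `p ^ n`, where `p < 1`. -/
lemma ae_expSeq_exists_lt (L : ℝ) : ∀ᵐ s ∂expSeq, ∃ k, L < s k := by
  set M := max L 0 with hM
  have hlt : expMeasure 1 (Iic M) < 1 := by
    have hc : (Ioi M)ᶜ = Iic M := compl_Ioi
    rw [← hc, prob_compl_eq_one_sub measurableSet_Ioi, expMeasure_one_Ioi (le_max_right _ _)]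
    exact ENNReal.sub_lt_self ENNReal.one_ne_top one_ne_zero (by simp [Real.exp_pos])
  rw [ae_iff]
  have hle : ∀ n : ℕ, expSeq {s | ¬ ∃ k, L < s k} ≤ (expMeasure 1 (Iic M)) ^ n := by
    intro n
    have := Measure.infinitePi_pi (fun _ : ℕ => expMeasure 1) (s := Finset.range n)
      (t := fun _ => Iic M) fun _ _ => measurableSet_Iic
    rw [Finset.prod_const, Finset.card_range] at this
    rw [← this]
    refine measure_mono fun s hs k _ => ?_
    have : ∀ k, s k ≤ L := by simpa using hs
    exact (this k).trans (le_max_left _ _)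
  exact le_antisymm (ge_of_tendsto' (ENNReal.tendsto_pow_atTop_nhds_zero_of_lt_one hlt) hle)
    zero_le

section

/-! ### Marked Poisson processes -/

/-- The weight of a marked renewal path, started at `x`, that has exactly `n` points up to `L`:
the product of the weights `W u z` of its points `u` with marks `z`. -/
noncomputable def pathWeight (W : ℝ × ℝ → ℝ≥0∞) (L : ℝ) :
    ℕ → ℝ → (ℕ → ℝ) → (ℕ → ℝ) → ℝ≥0∞
  | 0, x, σ, _ => if L < x + σ 0 then 1 else 0
  | n + 1, x, σ, z => (if x + σ 0 ≤ L then W (x + σ 0, z 0) else 0) *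
      pathWeight W L n (x + σ 0) (fun k => σ (k + 1)) (fun k => z (k + 1))

variable {W : ℝ × ℝ → ℝ≥0∞} {w : ℝ → ℝ} {L : ℝ}

lemma measurable_pathWeight (hW : Measurable W) (L : ℝ) (n : ℕ) :
    Measurable (fun p : ℝ × (ℕ → ℝ) × (ℕ → ℝ) => pathWeight W L n p.1 p.2.1 p.2.2) := by
  induction n with
  | zero =>
    simp only [pathWeight]
    exact Measurable.ite (measurableSet_lt measurable_const (by fun_prop)) measurable_const
      measurable_const
  | succ n ih =>
    simp only [pathWeight]
    refine Measurable.mul ?_ (ih.comp (f := fun p : ℝ × (ℕ → ℝ) × (ℕ → ℝ) =>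
      (p.1 + p.2.1 0, (fun k => p.2.1 (k + 1)), (fun k => p.2.2 (k + 1)))) (by fun_prop))
    exact Measurable.ite (measurableSet_le (by fun_prop) measurable_const)
      (hW.comp (by fun_prop)) measurable_const

lemma pathWeight_eq (n : ℕ) (x : ℝ) (σ z : ℕ → ℝ) :
    pathWeight W L n x σ z = (∏ k ∈ Finset.range n,
      if x + ∑ i ∈ Finset.range (k + 1), σ i ≤ L then
        W (x + ∑ i ∈ Finset.range (k + 1), σ i, z k) else 0) *
      if L < x + ∑ i ∈ Finset.range (n + 1), σ i then 1 else 0 := by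
  induction n generalizing x σ z with
  | zero => simp [pathWeight]
  | succ n ih =>
    rw [pathWeight, ih, Finset.prod_range_succ']
    have hs : ∀ m, x + ∑ i ∈ Finset.range (m + 1 + 1), σ i =
        x + σ 0 + ∑ i ∈ Finset.range (m + 1), σ (i + 1) := fun m => by
      rw [Finset.sum_range_succ']
      ring
    simp only [hs, zero_add, Finset.sum_range_one]
    ring

lemma lintegral_pathWeight_zero {x : ℝ} (hx : x ≤ L) :
    ∫⁻ σ, ∫⁻ z, pathWeight W L 0 x σ z ∂expSeq ∂expSeq =
      ENNReal.ofReal (Real.exp (-(L - x))) := by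
  simp only [pathWeight, lintegral_const, measure_univ, mul_one]
  have hk : MeasurePreserving (Function.eval 0) expSeq (expMeasure 1) :=
    measurePreserving_eval_infinitePi _ 0
  have h1 : (fun σ : ℕ → ℝ => if L < x + σ 0 then (1 : ℝ≥0∞) else 0) =
      fun σ => (Ioi (L - x)).indicator (fun _ => 1) (Function.eval 0 σ) := by
    funext σ
    simp only [indicator, mem_Ioi, Function.eval, sub_lt_iff_lt_add']
  rw [h1, hk.lintegral_comp (f := (Ioi (L - x)).indicator (fun _ => 1))
    (measurable_const.indicator measurableSet_Ioi), lintegral_indicator_const measurableSet_Ioi,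
    one_mul, expMeasure_one_Ioi (by linarith)]

lemma lintegral_pathWeight_succ (hW : Measurable W) (n : ℕ) (x : ℝ) :
    ∫⁻ σ, ∫⁻ z, pathWeight W L (n + 1) x σ z ∂expSeq ∂expSeq =
      ∫⁻ a, (if x + a ≤ L then ∫⁻ b, W (x + a, b) ∂(expMeasure 1) else 0) *
        ∫⁻ σ, ∫⁻ z, pathWeight W L n (x + a) σ z ∂expSeq ∂expSeq ∂(expMeasure 1) := by
  have hm := measurable_pathWeight hW L (n + 1)
  have hm' := measurable_pathWeight hW L n
  rw [lintegral_expSeq_cons (Measurable.lintegral_prod_right'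
    (f := fun p : (ℕ → ℝ) × (ℕ → ℝ) => pathWeight W L (n + 1) x p.1 p.2)
    (hm.comp (f := fun p : (ℕ → ℝ) × (ℕ → ℝ) => (x, p.1, p.2)) (by fun_prop)))]
  refine lintegral_congr fun a => ?_
  have hz : ∀ σ : ℕ → ℝ, Measurable (fun z => pathWeight W L n (x + a) σ z) := fun σ =>
    hm'.comp (f := fun z : ℕ → ℝ => (x + a, σ, z)) (by fun_prop)
  have hWa : Measurable (fun b => W (x + a, b)) := hW.comp (by fun_prop)
  have hstep : ∀ σ : ℕ → ℝ, ∫⁻ z, pathWeight W L (n + 1) x (consSeq a σ) z ∂expSeq =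
      (if x + a ≤ L then ∫⁻ b, W (x + a, b) ∂(expMeasure 1) else 0) *
        ∫⁻ z, pathWeight W L n (x + a) σ z ∂expSeq := by
    intro σ
    rw [lintegral_expSeq_cons (F := fun z => pathWeight W L (n + 1) x (consSeq a σ) z)
      (hm.comp (f := fun z : ℕ → ℝ => (x, consSeq a σ, z)) (by fun_prop))]
    have hcons : ∀ b z, pathWeight W L (n + 1) x (consSeq a σ) (consSeq b z) =
        (if x + a ≤ L then W (x + a, b) else 0) * pathWeight W L n (x + a) σ z := fun _ _ => rfl
    simp_rw [hcons, lintegral_const_mul _ (hz σ)]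
    by_cases hle : x + a ≤ L
    · simp_rw [if_pos hle]
      rw [lintegral_mul_const _ hWa]
    · simp [if_neg hle]
  simp_rw [hstep]
  refine lintegral_const_mul _ (Measurable.lintegral_prod_right'
    (f := fun p : (ℕ → ℝ) × (ℕ → ℝ) => pathWeight W L n (x + a) p.1 p.2)
    (hm'.comp (f := fun p : (ℕ → ℝ) × (ℕ → ℝ) => (x + a, p.1, p.2)) (by fun_prop)))

lemma setLIntegral_sub_pow {c : ℝ} (hc : 0 ≤ c) (n : ℕ) :
    ∫⁻ y in Ioc 0 c, ENNReal.ofReal ((c - y) ^ n / n.factorial) =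
      ENNReal.ofReal (c ^ (n + 1) / (n + 1).factorial) := by
  have hcont : Continuous (fun y : ℝ => (c - y) ^ n / n.factorial) := by fun_prop
  rw [← ofReal_integral_eq_lintegral_ofReal
    ((hcont.intervalIntegrable 0 c).1) ?_, ← intervalIntegral.integral_of_le hc]
  · congr 1
    rw [intervalIntegral.integral_div, intervalIntegral.integral_comp_sub_left (fun y => y ^ n) c,
      integral_pow, Nat.factorial_succ]
    push_cast
    simp
    field_simp
  · filter_upwards [ae_restrict_mem measurableSet_Ioc] with y hy
    have : 0 ≤ c - y := sub_nonneg.2 hy.2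
    show 0 ≤ _
    positivity

/-- The expected weight of the paths that have exactly `n` points up to `L`. -/
lemma lintegral_pathWeight (hW : Measurable W) (hw : Measurable w) (h0 : ∀ u, 0 ≤ w u)
    (hi : ∀ u v, IntervalIntegrable w volume u v)
    (hmean : ∀ u, u ≤ L → 0 ≤ u → ∫⁻ b, W (u, b) ∂(expMeasure 1) = ENNReal.ofReal (w u)) (n : ℕ) :
    ∀ x, 0 ≤ x → x ≤ L → ∫⁻ σ, ∫⁻ z, pathWeight W L n x σ z ∂expSeq ∂expSeq =
      ENNReal.ofReal (Real.exp (-(L - x)) * ((∫ u in x..L, w u) ^ n / n.factorial)) := by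
  induction n with
  | zero =>
    intro x _ hx
    rw [lintegral_pathWeight_zero hx]
    simp
  | succ n ih =>
    intro x hx0 hx
    -- With `u = x + a` the factors `exp (-a)` and `exp (-(L - u))` combine to `exp (-(L - x))`,
    -- which is free of `u`. What remains is `w u` times a power of `∫_u^L w`, integrated by
    -- substitution.
    have hmain : ∀ a ∈ Ioi (0 : ℝ), ENNReal.ofReal (Real.exp (-a)) *
        ((if x + a ≤ L then ∫⁻ b, W (x + a, b) ∂(expMeasure 1) else 0) *
          ∫⁻ σ, ∫⁻ z, pathWeight W L n (x + a) σ z ∂expSeq ∂expSeq) =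
        (Ioc x L).indicator (fun u => ENNReal.ofReal (Real.exp (-(L - x))) *
          (ENNReal.ofReal (w u) * ENNReal.ofReal
            (((∫ r in x..L, w r) - ∫ r in x..u, w r) ^ n / n.factorial))) (x + a) := by
      intro a ha
      have ha' : (0 : ℝ) < a := ha
      by_cases hle : x + a ≤ L
      · have hW0 : 0 ≤ ∫ r in (x + a)..L, w r :=
          intervalIntegral.integral_nonneg hle fun u _ => h0 u
        rw [indicator_of_mem (show x + a ∈ Ioc x L from ⟨by linarith, hle⟩), if_pos hle,
          hmean _ hle (by linarith), ih (x + a) (by linarith) hle,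
          ENNReal.ofReal_mul (Real.exp_nonneg _),
          ← intervalIntegral.integral_add_adjacent_intervals (hi x (x + a)) (hi (x + a) L),
          add_sub_cancel_left,
          show -(L - x) = -a + -(L - (x + a)) by ring, Real.exp_add,
          ENNReal.ofReal_mul (Real.exp_nonneg _)]
        ring
      · rw [if_neg hle, indicator_of_notMem (fun h => hle h.2), zero_mul, mul_zero]
    have hc := (continuous_primitive' hi x).measurable
    have hmeas : Measurable (fun u => ENNReal.ofReal (Real.exp (-(L - x))) *
          (ENNReal.ofReal (w u) * ENNReal.ofReal
            (((∫ r in x..L, w r) - ∫ r in x..u, w r) ^ n / n.factorial))) := by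
      fun_prop
    have hWx : 0 ≤ ∫ r in x..L, w r := intervalIntegral.integral_nonneg hx fun u _ => h0 u
    rw [lintegral_pathWeight_succ hW, lintegral_expMeasure_one ?_,
      setLIntegral_congr_fun measurableSet_Ioi hmain, ← lintegral_indicator measurableSet_Ioi]
    · have hshift : (fun a : ℝ => (Ioi (0 : ℝ)).indicator (fun a =>
          (Ioc x L).indicator (fun u => ENNReal.ofReal (Real.exp (-(L - x))) *
          (ENNReal.ofReal (w u) * ENNReal.ofReal
            (((∫ r in x..L, w r) - ∫ r in x..u, w r) ^ n / n.factorial))) (x + a)) a) =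
          fun a => (Ioc x L).indicator (fun u => ENNReal.ofReal (Real.exp (-(L - x))) *
          (ENNReal.ofReal (w u) * ENNReal.ofReal
            (((∫ r in x..L, w r) - ∫ r in x..u, w r) ^ n / n.factorial))) (x + a) := by
        funext a
        by_cases ha : 0 < a
        · rw [indicator_of_mem (mem_Ioi.2 ha)]
        · rw [indicator_of_notMem (by simpa using ha), indicator_of_notMem]
          exact fun h => ha (by have := h.1; linarith)
      rw [hshift, lintegral_add_left_eq_self (μ := volume) _ x,
        lintegral_indicator measurableSet_Ioc, lintegral_const_mul _ (by fun_prop),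
        lintegral_comp_primitive hw h0 hi hx (g := fun y => ENNReal.ofReal
          (((∫ r in x..L, w r) - y) ^ n / n.factorial)) (by fun_prop),
        setLIntegral_sub_pow hWx, ← ENNReal.ofReal_mul (Real.exp_nonneg _)]
    · have hm' := measurable_pathWeight hW L n
      refine Measurable.mul (Measurable.ite (measurableSet_le (by fun_prop) measurable_const)
        (Measurable.lintegral_prod_right' (f := fun p : ℝ × ℝ => W (x + p.1, p.2))
          (hW.comp (by fun_prop))) measurable_const) ?_
      refine Measurable.lintegral_prod_right' (f := fun p : ℝ × (ℕ → ℝ) =>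
        ∫⁻ z, pathWeight W L n (x + p.1) p.2 z ∂expSeq) ?_
      exact Measurable.lintegral_prod_right' (f := fun p : (ℝ × (ℕ → ℝ)) × (ℕ → ℝ) =>
        pathWeight W L n (x + p.1.1) p.1.2 p.2) (hm'.comp (f := fun p : (ℝ × (ℕ → ℝ)) × (ℕ → ℝ) =>
          (x + p.1.1, p.1.2, p.2)) (by fun_prop))

/-- Sorting the paths by their number of points up to `L` produces the exponential series of `∫ w`.
-/
lemma lintegral_tsum_pathWeight (hW : Measurable W) (hw : Measurable w) (h0 : ∀ u, 0 ≤ w u)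
    (hi : ∀ u v, IntervalIntegrable w volume u v)
    (hmean : ∀ u, u ≤ L → 0 ≤ u → ∫⁻ b, W (u, b) ∂(expMeasure 1) = ENNReal.ofReal (w u))
    (hL : 0 ≤ L) :
    ∫⁻ σ, ∫⁻ z, ∑' n, pathWeight W L n 0 σ z ∂expSeq ∂expSeq =
      ENNReal.ofReal (Real.exp ((∫ u in (0 : ℝ)..L, w u) - L)) := by
  have hm := fun n => measurable_pathWeight hW L n
  have hz : ∀ n, ∀ σ : ℕ → ℝ, Measurable (fun z => pathWeight W L n 0 σ z) := fun n σ =>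
    (hm n).comp (f := fun z : ℕ → ℝ => ((0 : ℝ), σ, z)) (by fun_prop)
  have hσ : ∀ n, Measurable (fun σ => ∫⁻ z, pathWeight W L n 0 σ z ∂expSeq) := fun n =>
    Measurable.lintegral_prod_right' (f := fun p : (ℕ → ℝ) × (ℕ → ℝ) => pathWeight W L n 0 p.1 p.2)
      ((hm n).comp (f := fun p : (ℕ → ℝ) × (ℕ → ℝ) => ((0 : ℝ), p.1, p.2)) (by fun_prop))
  have hpos : 0 ≤ ∫ u in (0 : ℝ)..L, w u := intervalIntegral.integral_nonneg hL fun u _ => h0 u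
  have h1 : ∀ σ : ℕ → ℝ, ∫⁻ z, ∑' n, pathWeight W L n 0 σ z ∂expSeq =
      ∑' n, ∫⁻ z, pathWeight W L n 0 σ z ∂expSeq := fun σ =>
    lintegral_tsum fun n => (hz n σ).aemeasurable
  simp_rw [h1]
  rw [lintegral_tsum fun n => (hσ n).aemeasurable]
  simp_rw [lintegral_pathWeight hW hw h0 hi hmean _ 0 le_rfl hL]
  have hs := (NormedSpace.expSeries_div_hasSum_exp (∫ u in (0 : ℝ)..L, w u)).mul_left
    (Real.exp (-(L - 0)))
  rw [← Real.exp_eq_exp_ℝ, ← Real.exp_add] at hs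
  rw [← ENNReal.ofReal_tsum_of_nonneg (fun n => by positivity) hs.summable, hs.tsum_eq]
  congr 2
  ring

/-- The number of points up to `L`, counted if they belong with their mark to `B`, of the renewal
path with interarrival times `σ` and marks `z`. -/
noncomputable def markedCount (B : Set (ℝ × ℝ)) (L : ℝ) (σ z : ℕ → ℝ) : ℕ :=
  {k : ℕ | ∑ i ∈ Finset.range (k + 1), σ i ≤ L ∧
    (∑ i ∈ Finset.range (k + 1), σ i, z k) ∈ B}.ncard

open scoped Classical in
-- Only one term survives, the one at the first index `N` with `L < T N`; as indices start at `0`,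
-- exactly the `N` points before it are at most `L`.
lemma tsum_pathWeight_eq_pow {B : Set (ℝ × ℝ)} {σ : ℕ → ℝ} (hσ : ∀ k, 0 ≤ σ k)
    (hex : ∃ k, L < σ k) (z : ℕ → ℝ) (s : ℝ≥0∞) :
    ∑' n, pathWeight (fun p => if p ∈ B then s else 1) L n 0 σ z = s ^ markedCount B L σ z := by
  set T : ℕ → ℝ := fun n => ∑ i ∈ Finset.range (n + 1), σ i with hT
  have hmono : Monotone T := monotone_nat_of_le_succ fun n => by
    simp only [hT]
    rw [Finset.sum_range_succ _ (n + 1)]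
    linarith [hσ (n + 1)]
  have hexT : ∃ n, L < T n := by
    obtain ⟨k, hk⟩ := hex
    refine ⟨k, hk.trans_le (Finset.single_le_sum (f := σ) (fun i _ => hσ i) ?_)⟩
    simp
  set N := Nat.find hexT with hN
  have hNs : L < T N := Nat.find_spec hexT
  have hNm : ∀ k < N, T k ≤ L := fun k hk => not_lt.1 (Nat.find_min hexT hk)
  have heq : ∀ n, pathWeight (fun p => if p ∈ B then s else 1) L n 0 σ z =
      (∏ k ∈ Finset.range n, if T k ≤ L then (if (T k, z k) ∈ B then s else 1) else 0) *
        if L < T n then 1 else 0 := by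
    intro n
    rw [pathWeight_eq]
    simp only [zero_add, hT]
  rw [tsum_eq_single N]
  · rw [heq, if_pos hNs, mul_one]
    have h1 : ∀ k ∈ Finset.range N,
        (if T k ≤ L then (if (T k, z k) ∈ B then s else 1) else 0) =
          if (T k, z k) ∈ B then s else 1 := fun k hk =>
      if_pos (hNm k (Finset.mem_range.1 hk))
    rw [Finset.prod_congr rfl h1, Finset.prod_ite, Finset.prod_const, Finset.prod_const_one,
      mul_one, markedCount]
    congr 1
    rw [← Set.ncard_coe_finset]
    congr 1
    ext k
    simp only [Finset.coe_filter, Finset.mem_range, mem_ofPred_eq]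
    constructor
    · exact fun h => ⟨hNm k h.1, h.2⟩
    · refine fun h => ⟨?_, h.2⟩
      by_contra! hle
      exact absurd (hNs.trans_le (hmono hle)) (not_lt.2 h.1)
  · intro n hn
    rw [heq]
    rcases lt_or_gt_of_ne hn with hlt | hgt
    · rw [if_neg (not_lt.2 (hNm n hlt)), mul_zero]
    · rw [Finset.prod_eq_zero (Finset.mem_range.2 hgt) (if_neg (not_le.2 hNs)), zero_mul]

end

/-! ### Thinning of the Poisson process through generating functions -/

section

open scoped Classical in
lemma measurable_ncard {α : Type*} [MeasurableSpace α] {S : α → Set ℕ}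
    (hS : ∀ k, MeasurableSet {a | k ∈ S a}) : Measurable (fun a => (S a).ncard) := by
  have hm : Measurable (fun a => ∑' k : ℕ, if k ∈ S a then (1 : ℝ≥0∞) else 0) :=
    Measurable.tsum fun k => Measurable.ite (hS k) measurable_const measurable_const
  -- The conventions agree on infinite sets: `ncard` is `0`, and so is the real part of the infinite
  -- sum.
  have heq : ∀ a, (S a).ncard = ⌊(∑' k : ℕ, if k ∈ S a then (1 : ℝ≥0∞) else 0).toReal⌋₊ := by
    intro a
    have h1 : (∑' k : ℕ, if k ∈ S a then (1 : ℝ≥0∞) else 0) = Measure.count (S a) := by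
      rw [Measure.count_apply (MeasurableSet.of_discrete), ← ENNReal.tsum_set_one,
        tsum_subtype (S a) (fun _ => (1 : ℝ≥0∞))]
      rfl
    rw [h1]
    rcases (S a).finite_or_infinite with hf | hi
    · rw [Measure.count_apply_finite _ hf, Set.ncard_eq_toFinset_card _ hf]
      simp
    · rw [Measure.count_apply_infinite hi, hi.ncard]
      simp
  simp_rw [heq]
  exact Nat.measurable_floor.comp hm.ennreal_toReal

lemma measurable_markedCount {B : Set (ℝ × ℝ)} (hB : MeasurableSet B) (L : ℝ) :
    Measurable (fun q : (ℕ → ℝ) × (ℕ → ℝ) => markedCount B L q.1 q.2) := by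
  refine measurable_ncard fun k => MeasurableSet.inter ?_ ?_
  · exact measurableSet_le (f := fun q : (ℕ → ℝ) × (ℕ → ℝ) => ∑ i ∈ Finset.range (k + 1), q.1 i)
      (by fun_prop) measurable_const
  · exact hB.preimage (f := fun q : (ℕ → ℝ) × (ℕ → ℝ) =>
      (∑ i ∈ Finset.range (k + 1), q.1 i, q.2 k)) (by fun_prop)

/-- The intensity of the points of the standard Poisson process with their mark in `B`. -/
noncomputable def markProb (B : Set (ℝ × ℝ)) (u : ℝ) : ℝ := (expMeasure 1).real {b | (u, b) ∈ B}

variable {B : Set (ℝ × ℝ)} {L : ℝ}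

lemma measurable_markProb (hB : MeasurableSet B) : Measurable (markProb B) :=
  (measurable_measure_prodMk_left hB).ennreal_toReal

lemma intervalIntegrable_markProb (hB : MeasurableSet B) (u v : ℝ) :
    IntervalIntegrable (markProb B) volume u v := by
  rw [intervalIntegrable_iff]
  refine Measure.integrableOn_of_bounded (M := 1) (by simp)
    (measurable_markProb hB).aestronglyMeasurable (Eventually.of_forall fun x => ?_)
  rw [Real.norm_of_nonneg (show 0 ≤ markProb B x from measureReal_nonneg)]
  exact measureReal_le_one

open scoped Classical in
-- Give each point in `B` the weight `s`. Averaging over the mark of a point at `u` yields `w u = 1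
-- + (s - 1) * markProb B u`, and `∫ w - L` is the Poisson exponent.
lemma lintegral_pow_markedCount (hB : MeasurableSet B) (hL : 0 ≤ L) {s : ℝ} (hs : 0 < s) :
    ∫⁻ q, ENNReal.ofReal s ^ markedCount B L q.1 q.2 ∂(expSeq.prod expSeq) =
      ENNReal.ofReal (Real.exp ((s - 1) * ∫ u in (0 : ℝ)..L, markProb B u)) := by
  have hW : Measurable (fun p : ℝ × ℝ => if p ∈ B then ENNReal.ofReal s else 1) :=
    Measurable.ite hB measurable_const measurable_const
  set w : ℝ → ℝ := fun u => 1 + (s - 1) * markProb B u with hw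
  have hwm : Measurable w := by
    have := measurable_markProb hB
    fun_prop
  have hp0 : ∀ u, 0 ≤ markProb B u := fun u => measureReal_nonneg
  have hp1 : ∀ u, markProb B u ≤ 1 := fun u => measureReal_le_one
  have hw0 : ∀ u, 0 ≤ w u := fun u => by
    have h1 := hp0 u
    have h2 := hp1 u
    simp only [hw]
    nlinarith
  have hi : ∀ u v, IntervalIntegrable w volume u v := fun u v =>
    intervalIntegrable_const.add ((intervalIntegrable_markProb hB u v).const_mul _)
  have hmean : ∀ u, ∫⁻ b, (if (u, b) ∈ B then ENNReal.ofReal s else 1) ∂(expMeasure 1) =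
      ENNReal.ofReal (w u) := by
    intro u
    have hBu : MeasurableSet {b | (u, b) ∈ B} := measurable_prodMk_left hB
    have hite : ∀ b, (if (u, b) ∈ B then ENNReal.ofReal s else 1) =
        {b | (u, b) ∈ B}.indicator (fun _ => ENNReal.ofReal s) b +
          {b | (u, b) ∈ B}ᶜ.indicator (fun _ => 1) b := by
      intro b
      by_cases hb : (u, b) ∈ B <;> simp [indicator, hb]
    simp_rw [hite]
    rw [lintegral_add_left (measurable_const.indicator hBu), lintegral_indicator_const hBu,
      lintegral_indicator_const hBu.compl, ← ofReal_measureReal (s := {b | (u, b) ∈ B}),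
      ← ofReal_measureReal (s := {b | (u, b) ∈ B}ᶜ), probReal_compl_eq_one_sub hBu,
      ← ENNReal.ofReal_mul hs.le, one_mul, ← ENNReal.ofReal_add
      (mul_nonneg hs.le measureReal_nonneg) (sub_nonneg.2 measureReal_le_one)]
    congr 1
    simp only [hw, markProb]
    ring
  have hm : Measurable (fun q : (ℕ → ℝ) × (ℕ → ℝ) =>
      ENNReal.ofReal s ^ markedCount B L q.1 q.2) :=
    (measurable_from_nat (f := fun k => ENNReal.ofReal s ^ k)).comp (measurable_markedCount hB L)
  rw [lintegral_prod _ hm.aemeasurable]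
  have hae : ∀ᵐ σ ∂expSeq, ∫⁻ z, ENNReal.ofReal s ^ markedCount B L σ z ∂expSeq =
      ∫⁻ z, ∑' n, pathWeight (fun p => if p ∈ B then ENNReal.ofReal s else 1) L n 0 σ z
        ∂expSeq := by
    filter_upwards [ae_expSeq_nonneg, ae_expSeq_exists_lt L] with σ h1 h2
    exact lintegral_congr fun z => (tsum_pathWeight_eq_pow h1 h2 z _).symm
  rw [lintegral_congr_ae hae, lintegral_tsum_pathWeight hW hwm hw0 hi (fun u _ _ => hmean u) hL]
  congr 2
  simp only [hw]
  rw [intervalIntegral.integral_add intervalIntegrable_const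
    ((intervalIntegrable_markProb hB 0 L).const_mul _), intervalIntegral.integral_const_mul]
  simp

/-- The number of points of a marked Poisson process that belong to `B` is Poisson distributed. -/
theorem map_markedCount (hB : MeasurableSet B) (hL : 0 ≤ L) :
    (expSeq.prod expSeq).map (fun q => markedCount B L q.1 q.2) =
      poissonMeasure (∫ u in (0 : ℝ)..L, markProb B u).toNNReal := by
  set V := ∫ u in (0 : ℝ)..L, markProb B u with hV
  have hV0 : 0 ≤ V := intervalIntegral.integral_nonneg hL fun u _ => measureReal_nonneg
  have hN := measurable_markedCount hB L
  set N : (ℕ → ℝ) × (ℕ → ℝ) → ℕ := fun q => markedCount B L q.1 q.2 with hNdef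
  have hX : Measurable (fun q => (N q : ℝ)) := measurable_from_nat.comp hN
  have hlin : ∀ θ : ℝ, ∫⁻ q, ENNReal.ofReal (Real.exp (θ * N q)) ∂(expSeq.prod expSeq) =
      ENNReal.ofReal (Real.exp (V * (Real.exp θ - 1))) := by
    intro θ
    have := lintegral_pow_markedCount hB hL (Real.exp_pos θ)
    rw [mul_comm V, ← this]
    refine lintegral_congr fun q => ?_
    rw [← ENNReal.ofReal_pow (Real.exp_nonneg _), ← Real.exp_nat_mul, mul_comm]
  have hmeas : ∀ θ : ℝ, Measurable (fun q => Real.exp (θ * N q)) := fun θ => by fun_prop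
  have hmgf : mgf (fun q => (N q : ℝ)) (expSeq.prod expSeq) =
      mgf (fun k : ℕ => (k : ℝ)) (poissonMeasure V.toNNReal) := by
    funext θ
    rw [mgf_poissonMeasure, mgf, integral_eq_lintegral_of_nonneg_ae
      (Eventually.of_forall fun q => Real.exp_nonneg _) (hmeas θ).aestronglyMeasurable, hlin,
      ENNReal.toReal_ofReal (Real.exp_nonneg _), Real.coe_toNNReal _ hV0]
  -- Since the moment generating function is finite on all of `ℝ`, equality extends to the complex
  -- plane and so determines the law.
  have hset : integrableExpSet (fun q => (N q : ℝ)) (expSeq.prod expSeq) = univ := by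
    refine eq_univ_of_forall fun θ => ?_
    refine ⟨(hmeas θ).aestronglyMeasurable, ?_⟩
    rw [hasFiniteIntegral_iff_ofReal (Eventually.of_forall fun q => Real.exp_nonneg _), hlin]
    exact ENNReal.ofReal_lt_top
  have hcomplex : complexMGF (fun q => (N q : ℝ)) (expSeq.prod expSeq) =
      complexMGF (fun k : ℕ => (k : ℝ)) (poissonMeasure V.toNNReal) := by
    funext c
    exact eqOn_complexMGF_of_mgf hmgf (by simp [hset])
  have hmap := Measure.ext_of_complexMGF_eq hX.aemeasurable
    (measurable_from_nat (f := fun k : ℕ => (k : ℝ))).aemeasurable hcomplex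
  refine Measure.ext_of_singleton fun k => ?_
  have h1 : (expSeq.prod expSeq).map (fun q => (N q : ℝ)) {(k : ℝ)} =
      (poissonMeasure V.toNNReal).map (fun k : ℕ => (k : ℝ)) {(k : ℝ)} := by rw [hmap]
  rw [Measure.map_apply hX (measurableSet_singleton _), Measure.map_apply measurable_from_nat
    (measurableSet_singleton _)] at h1
  rw [Measure.map_apply hN (measurableSet_singleton _)]
  convert! h1 using 2
  · ext q; simp
  · ext j; simp

end

/-! ### Càdlàg paths -/

lemma cumulative_nonneg {E : Type*} {c : E → ℝ≥0} {f : ℝ≥0 → E} {u v : ℝ≥0} (h : u ≤ v) :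
    0 ≤ cumulative c f u v :=
  intervalIntegral.integral_nonneg h fun _ _ => NNReal.coe_nonneg _

/-- The first time at which the cumulative rate reaches the level `u`. -/
noncomputable def firstPassage {E : Type*} (lam : E → ℝ≥0) (f : ℝ≥0 → E) (u : ℝ) : ℝ≥0∞ :=
  ⨅ (s : ℝ≥0) (_ : u ≤ cumulative lam f 0 s), (s : ℝ≥0∞)

/-- The pairs of an arrival time, on the scale of the unit-rate Poisson process, and a standardized
service requirement such that the job is still in the system at time `t`. -/
def inSystem {E : Type*} (lam kap mu : E → ℝ≥0) (f : ℝ≥0 → E) (t : ℝ≥0) : Set (ℝ × ℝ) :=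
  {p | ((cumulative mu f (firstPassage lam f p.1).toNNReal t : ℝ) : EReal) <
    serviceRequirement kap (f (firstPassage lam f p.1).toNNReal) p.2}

/-- The job survives exactly when its standard exponential variable exceeds `kap` times the work
done. If `kap` vanishes the service requirement is infinite, in agreement with `exp 0 = 1`. -/
lemma markProb_inSystem {E : Type*} {lam kap mu : E → ℝ≥0} {f : ℝ≥0 → E} {u : ℝ} {t : ℝ≥0}
    (hu : firstPassage lam f u ≤ t) :
    markProb (inSystem lam kap mu f t) u =
      Real.exp (-((kap (f (firstPassage lam f u).toNNReal) : ℝ) *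
        cumulative mu f (firstPassage lam f u).toNNReal t)) := by
  set τ := (firstPassage lam f u).toNNReal with hτ
  have hτt : τ ≤ t := by
    have := ENNReal.toNNReal_mono ENNReal.coe_ne_top hu
    rwa [ENNReal.toNNReal_coe] at this
  have hc : 0 ≤ cumulative mu f τ t := cumulative_nonneg hτt
  rcases eq_zero_or_pos (kap (f τ)) with h0 | hpos
  · have : {b : ℝ | (u, b) ∈ inSystem lam kap mu f t} = univ := by
      refine eq_univ_of_forall fun b => ?_
      show ((cumulative mu f τ t : ℝ) : EReal) < serviceRequirement kap (f τ) b
      rw [serviceRequirement, if_neg (by simp [h0])]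
      exact EReal.coe_lt_top _
    rw [markProb, this, h0]
    simp
  · have hpos' : (0 : ℝ) < kap (f τ) := by exact_mod_cast hpos
    have : {b : ℝ | (u, b) ∈ inSystem lam kap mu f t} =
        Ioi ((kap (f τ) : ℝ) * cumulative mu f τ t) := by
      ext b
      show ((cumulative mu f τ t : ℝ) : EReal) < serviceRequirement kap (f τ) b ↔ _
      rw [serviceRequirement, if_pos hpos, EReal.coe_lt_coe_iff, lt_div_iff₀ hpos', mem_Ioi,
        mul_comm]
    rw [markProb, this, measureReal_def, expMeasure_one_Ioi (by positivity),
      ENNReal.toReal_ofReal (Real.exp_nonneg _)]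

section Path

variable {E : Type*} [TopologicalSpace E] {c lam kap mu : E → ℝ≥0} {f : ℝ≥0 → E}

/-- The one-sided limits bound `c ∘ f` near every point, and compactness of `[0, T]` makes the bound
global. -/
lemma IsCadlag.exists_le (hf : IsCadlag f) (hc : Continuous c) (T : ℝ≥0) :
    ∃ M : ℝ≥0, ∀ s ≤ T, c (f s) ≤ M := by
  have key : ∃ M : ℝ≥0, ∀ s ∈ Icc 0 T, c (f s) ≤ M := by
    refine isCompact_Icc.induction_on (p := fun S => ∃ M : ℝ≥0, ∀ s ∈ S, c (f s) ≤ M)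
      ⟨0, by simp⟩ (fun s t hst ⟨M, hM⟩ => ⟨M, fun x hx => hM x (hst hx)⟩)
      (fun s t ⟨M, hM⟩ ⟨M', hM'⟩ => ⟨max M M', fun x hx => hx.elim
        (fun h => (hM x h).trans (le_max_left _ _)) fun h => (hM' x h).trans (le_max_right _ _)⟩)
      fun x _ => ?_
    obtain ⟨hr, l, hl⟩ := hf x
    have h1 : ∀ᶠ y in 𝓝[≥] x, c (f y) < c (f x) + 1 :=
      ((hc.tendsto _).comp hr).eventually_lt_const (lt_add_one _)
    have h2 : ∀ᶠ y in 𝓝[<] x, c (f y) < c l + 1 :=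
      ((hc.tendsto _).comp hl).eventually_lt_const (lt_add_one _)
    have h3 : ∀ᶠ y in 𝓝 x, c (f y) ≤ max (c (f x) + 1) (c l + 1) := by
      rw [← nhdsLT_sup_nhdsGE x, eventually_sup]
      exact ⟨h2.mono fun y hy => hy.le.trans (le_max_right _ _),
        h1.mono fun y hy => hy.le.trans (le_max_left _ _)⟩
    exact ⟨_, mem_nhdsWithin_of_mem_nhds h3, _, fun y hy => hy⟩
  obtain ⟨M, hM⟩ := key
  exact ⟨M, fun s hs => hM s ⟨zero_le, hs⟩⟩

variable [MeasurableSpace E] [BorelSpace E]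

/-- By right-continuity the evaluation is the limit of evaluations at grid times `d n s > s`. Each
of these involves only countably many coordinates, so the product σ-algebra on paths suffices. -/
lemma measurable_eval_cadlag (hc : Continuous c) :
    Measurable (fun p : {f : ℝ≥0 → E // IsCadlag f} × ℝ≥0 => c (p.1.1 p.2)) := by
  set d : ℕ → ℝ≥0 → ℝ≥0 := fun n s => (⌊(n + 1) * s⌋₊ + 1) / (n + 1) with hd
  have hdlt : ∀ n s, s < d n s := fun n s => by
    rw [hd, lt_div_iff₀ (by positivity), mul_comm]
    exact Nat.lt_floor_add_one _
  have hdle : ∀ n s, d n s ≤ s + 1 / (n + 1) := fun n s => by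
    simp only [hd]
    rw [add_div]
    gcongr
    rw [div_le_iff₀ (by positivity), mul_comm s]
    exact Nat.floor_le zero_le
  have hdlim : ∀ s, Tendsto (fun n => d n s) atTop (𝓝[≥] s) := fun s => by
    refine tendsto_nhdsWithin_iff.2 ⟨?_, Eventually.of_forall fun n => (hdlt n s).le⟩
    refine tendsto_of_tendsto_of_tendsto_of_le_of_le tendsto_const_nhds
      (h := fun n : ℕ => s + 1 / ((n : ℝ≥0) + 1)) ?_ (fun n => (hdlt n s).le) (fun n => hdle n s)
    have : Tendsto (fun n : ℕ => 1 / ((n : ℝ≥0) + 1)) atTop (𝓝 0) :=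
      tendsto_one_div_add_atTop_nhds_zero_nat
    simpa using this.const_add s
  have hlim : ∀ p : {f : ℝ≥0 → E // IsCadlag f} × ℝ≥0,
      Tendsto (fun n => c (p.1.1 (d n p.2))) atTop (𝓝 (c (p.1.1 p.2))) := fun p =>
    ((hc.tendsto (p.1.1 p.2)).comp (p.1.2 p.2).1.tendsto).comp (hdlim p.2)
  refine measurable_of_tendsto_metrizable
    (f := fun n (p : {f : ℝ≥0 → E // IsCadlag f} × ℝ≥0) => c (p.1.1 (d n p.2)))
    (fun n => ?_) (tendsto_pi_nhds.2 hlim)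
  have hcount : Measurable (fun q : {f : ℝ≥0 → E // IsCadlag f} × ℕ =>
      c (q.1.1 ((q.2 + 1 : ℝ≥0) / (n + 1)))) :=
    measurable_from_prod_countable_left fun j =>
      hc.measurable.comp ((measurable_pi_apply ((j + 1 : ℝ≥0) / (n + 1))).comp
        (measurable_subtype_coe (p := fun f : ℝ≥0 → E => IsCadlag f)))
  exact hcount.comp (f := fun p : {f : ℝ≥0 → E // IsCadlag f} × ℝ≥0 => (p.1, ⌊(n + 1) * p.2⌋₊))
    (measurable_fst.prodMk (Nat.measurable_floor.comp (by fun_prop)))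

lemma measurable_rate_cadlag (hc : Continuous c) :
    Measurable (fun p : {f : ℝ≥0 → E // IsCadlag f} × ℝ => (c (p.1.1 p.2.toNNReal) : ℝ)) :=
  ((measurable_eval_cadlag hc).comp
    (f := fun p : {f : ℝ≥0 → E // IsCadlag f} × ℝ => (p.1, p.2.toNNReal))
      (by fun_prop)).coe_nnreal_real

lemma IsCadlag.measurable_rate (hf : IsCadlag f) (hc : Continuous c) :
    Measurable (fun r : ℝ => (c (f r.toNNReal) : ℝ)) :=
  (measurable_rate_cadlag hc).comp
    (f := fun r : ℝ => ((⟨f, hf⟩ : {f : ℝ≥0 → E // IsCadlag f}), r)) (by fun_prop)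

lemma IsCadlag.intervalIntegrable_rate (hf : IsCadlag f) (hc : Continuous c) (u v : ℝ) :
    IntervalIntegrable (fun r : ℝ => (c (f r.toNNReal) : ℝ)) volume u v := by
  obtain ⟨M, hM⟩ := hf.exists_le hc (max u v).toNNReal
  rw [intervalIntegrable_iff]
  refine Measure.integrableOn_of_bounded (M := M) (by simp)
    (hf.measurable_rate hc).aestronglyMeasurable ?_
  filter_upwards [ae_restrict_mem measurableSet_uIoc] with x hx
  rw [Real.norm_of_nonneg (NNReal.coe_nonneg _), NNReal.coe_le_coe]
  exact hM _ (Real.toNNReal_le_toNNReal hx.2)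

lemma cumulative_add (hf : IsCadlag f) (hc : Continuous c) (u v : ℝ≥0) :
    cumulative c f 0 u + cumulative c f u v = cumulative c f 0 v :=
  intervalIntegral.integral_add_adjacent_intervals (hf.intervalIntegrable_rate hc _ _)
    (hf.intervalIntegrable_rate hc _ _)

lemma monotone_cumulative (hf : IsCadlag f) (hc : Continuous c) :
    Monotone (fun s => cumulative c f 0 s) := by
  intro s s' h
  have h1 := cumulative_add hf hc s s'
  have h2 : 0 ≤ cumulative c f s s' := cumulative_nonneg h
  show _ ≤ _
  linarith

lemma continuous_cumulative (hf : IsCadlag f) (hc : Continuous c) :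
    Continuous (fun s : ℝ≥0 => cumulative c f 0 s) :=
  (continuous_primitive' (hf.intervalIntegrable_rate hc) _).comp NNReal.continuous_coe

lemma measurable_cumulative_zero (hc : Continuous c) :
    Measurable (fun p : {f : ℝ≥0 → E // IsCadlag f} × ℝ≥0 => cumulative c p.1.1 0 p.2) := by
  have heq : ∀ p : {f : ℝ≥0 → E // IsCadlag f} × ℝ≥0, cumulative c p.1.1 0 p.2 =
      ∫ r : ℝ, (Ioc (0 : ℝ) p.2).indicator (fun r => (c (p.1.1 r.toNNReal) : ℝ)) r := fun p => by
    rw [integral_indicator measurableSet_Ioc, cumulative, NNReal.coe_zero,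
      intervalIntegral.integral_of_le (NNReal.coe_nonneg _)]
  simp_rw [heq]
  have hm : Measurable (fun q : ({f : ℝ≥0 → E // IsCadlag f} × ℝ≥0) × ℝ =>
      {q : ({f : ℝ≥0 → E // IsCadlag f} × ℝ≥0) × ℝ | q.2 ∈ Ioc (0 : ℝ) q.1.2}.indicator
        (fun q => (c (q.1.1.1 q.2.toNNReal) : ℝ)) q) := by
    refine Measurable.indicator ((measurable_rate_cadlag hc).comp
      (f := fun q : ({f : ℝ≥0 → E // IsCadlag f} × ℝ≥0) × ℝ => (q.1.1, q.2)) (by fun_prop)) ?_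
    have h2 : Measurable (fun q : ({f : ℝ≥0 → E // IsCadlag f} × ℝ≥0) × ℝ => (q.1.2 : ℝ)) := by
      fun_prop
    exact (measurableSet_lt measurable_const measurable_snd).inter
      (measurableSet_le measurable_snd h2)
  exact (hm.stronglyMeasurable.integral_prod_right' (ν := volume)).measurable

lemma measurable_cumulative (hc : Continuous c) :
    Measurable (fun p : {f : ℝ≥0 → E // IsCadlag f} × ℝ≥0 × ℝ≥0 =>
      cumulative c p.1.1 p.2.1 p.2.2) := by
  have heq : ∀ p : {f : ℝ≥0 → E // IsCadlag f} × ℝ≥0 × ℝ≥0, cumulative c p.1.1 p.2.1 p.2.2 =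
      cumulative c p.1.1 0 p.2.2 - cumulative c p.1.1 0 p.2.1 := fun p => by
    rw [← cumulative_add p.1.2 hc p.2.1 p.2.2]; ring
  simp_rw [heq]
  exact ((measurable_cumulative_zero hc).comp
    (f := fun p : {f : ℝ≥0 → E // IsCadlag f} × ℝ≥0 × ℝ≥0 => (p.1, p.2.2)) (by fun_prop)).sub
    ((measurable_cumulative_zero hc).comp
    (f := fun p : {f : ℝ≥0 → E // IsCadlag f} × ℝ≥0 × ℝ≥0 => (p.1, p.2.1)) (by fun_prop))

/-- Continuity of the cumulative rate makes the level reached at the infimum itself. -/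
lemma firstPassage_le_iff (hf : IsCadlag f) (hlam : Continuous lam) {u : ℝ} {s : ℝ≥0} :
    firstPassage lam f u ≤ s ↔ u ≤ cumulative lam f 0 s := by
  refine ⟨fun h => ?_, fun h => iInf₂_le s h⟩
  have hgt : ∀ s' > s, u ≤ cumulative lam f 0 s' := fun s' hs' => by
    obtain ⟨r, hr⟩ := iInf_lt_iff.1 (h.trans_lt (ENNReal.coe_lt_coe.2 hs'))
    obtain ⟨hur, hrs⟩ := iInf_lt_iff.1 hr
    exact hur.trans (monotone_cumulative hf hlam (ENNReal.coe_lt_coe.1 hrs).le)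
  refine ge_of_tendsto ((continuous_cumulative hf hlam).continuousWithinAt (s := Ioi s) (x := s)) ?_
  filter_upwards [self_mem_nhdsWithin] with s' hs' using hgt s' hs'

lemma measurable_firstPassage (hlam : Continuous lam) :
    Measurable (fun p : {f : ℝ≥0 → E // IsCadlag f} × ℝ => firstPassage lam p.1.1 p.2) := by
  refine measurable_of_Iic fun a => ?_
  induction a with
  | top => simp
  | coe s =>
    have : (fun p : {f : ℝ≥0 → E // IsCadlag f} × ℝ => firstPassage lam p.1.1 p.2) ⁻¹' Iic ↑s =
        {p | p.2 ≤ cumulative lam p.1.1 0 s} := by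
      ext p
      exact firstPassage_le_iff p.1.2 hlam
    rw [this]
    exact measurableSet_le measurable_snd ((measurable_cumulative_zero hlam).comp
      (f := fun p : {f : ℝ≥0 → E // IsCadlag f} × ℝ => (p.1, s)) (by fun_prop))

/-- This fails at the end of a flat stretch of the cumulative rate; `ae_primitive_lt` supplies the
hypothesis at almost every time with positive rate. -/
lemma firstPassage_cumulative (hf : IsCadlag f) (hlam : Continuous lam) {s : ℝ≥0}
    (hs : ∀ s' < s, cumulative lam f 0 s' < cumulative lam f 0 s) :
    firstPassage lam f (cumulative lam f 0 s) = s := by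
  refine le_antisymm ((firstPassage_le_iff hf hlam).2 le_rfl) (le_of_not_gt fun hlt => ?_)
  obtain ⟨s', h1, h2⟩ := ENNReal.lt_iff_exists_nnreal_btwn.1 hlt
  exact absurd ((firstPassage_le_iff hf hlam).1 h1.le) (hs s' (ENNReal.coe_lt_coe.1 h2)).not_ge

/-- An arrival time is the first passage at the corresponding Poisson time, so arriving by `t` means
that the Poisson time is at most the cumulative rate at `t`. -/
lemma jobsInSystem_eq_markedCount (hf : IsCadlag f) (hlam : Continuous lam) (σ z : ℕ → ℝ)
    (t : ℝ≥0) : jobsInSystem lam kap mu f σ z t =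
      markedCount (inSystem lam kap mu f t) (cumulative lam f 0 t) σ z := by
  unfold jobsInSystem markedCount
  congr 1
  ext k
  exact and_congr_left' (firstPassage_le_iff hf hlam)

lemma measurableSet_inSystem_uncurry (hlam : Continuous lam) (hkap : Continuous kap)
    (hmu : Continuous mu) (t : ℝ≥0) :
    MeasurableSet {q : {f : ℝ≥0 → E // IsCadlag f} × ℝ × ℝ |
      q.2 ∈ inSystem lam kap mu q.1.1 t} := by
  have hτ : Measurable (fun q : {f : ℝ≥0 → E // IsCadlag f} × ℝ × ℝ =>
      (firstPassage lam q.1.1 q.2.1).toNNReal) :=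
    ((measurable_firstPassage hlam).comp
      (f := fun q : {f : ℝ≥0 → E // IsCadlag f} × ℝ × ℝ => (q.1, q.2.1))
      (by fun_prop)).ennreal_toNNReal
  have hk : Measurable (fun q : {f : ℝ≥0 → E // IsCadlag f} × ℝ × ℝ =>
      kap (q.1.1 (firstPassage lam q.1.1 q.2.1).toNNReal)) :=
    (measurable_eval_cadlag hkap).comp (measurable_fst.prodMk hτ)
  have h1 : Measurable (fun q : {f : ℝ≥0 → E // IsCadlag f} × ℝ × ℝ =>
      ((cumulative mu q.1.1 (firstPassage lam q.1.1 q.2.1).toNNReal t : ℝ) : EReal)) :=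
    ((measurable_cumulative hmu).comp
      (measurable_fst.prodMk (hτ.prodMk (measurable_const (a := t))))).coe_real_ereal
  have h2 : Measurable (fun q : {f : ℝ≥0 → E // IsCadlag f} × ℝ × ℝ =>
      serviceRequirement kap (q.1.1 (firstPassage lam q.1.1 q.2.1).toNNReal) q.2.2) :=
    Measurable.ite (measurableSet_lt measurable_const hk)
      (measurable_snd.snd.div hk.coe_nnreal_real).coe_real_ereal measurable_const
  exact measurableSet_lt h1 h2

lemma measurableSet_inSystem (hf : IsCadlag f) (hlam : Continuous lam) (hkap : Continuous kap)
    (hmu : Continuous mu) (t : ℝ≥0) : MeasurableSet (inSystem lam kap mu f t) :=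
  (measurableSet_inSystem_uncurry hlam hkap hmu t).preimage
    (f := fun p : ℝ × ℝ => ((⟨f, hf⟩ : {f : ℝ≥0 → E // IsCadlag f}), p)) (by fun_prop)

lemma measurable_jobsInSystem (hlam : Continuous lam) (hkap : Continuous kap)
    (hmu : Continuous mu) (t : ℝ≥0) :
    Measurable (fun q : {f : ℝ≥0 → E // IsCadlag f} × (ℕ → ℝ) × (ℕ → ℝ) =>
      jobsInSystem lam kap mu q.1.1 q.2.1 q.2.2 t) := by
  have hT : ∀ k, Measurable (fun q : {f : ℝ≥0 → E // IsCadlag f} × (ℕ → ℝ) × (ℕ → ℝ) =>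
      ∑ i ∈ Finset.range (k + 1), q.2.1 i) := fun k => by fun_prop
  have hL : Measurable (fun q : {f : ℝ≥0 → E // IsCadlag f} × (ℕ → ℝ) × (ℕ → ℝ) =>
      cumulative lam q.1.1 0 t) :=
    (measurable_cumulative_zero hlam).comp (measurable_fst.prodMk measurable_const)
  have heq : ∀ q : {f : ℝ≥0 → E // IsCadlag f} × (ℕ → ℝ) × (ℕ → ℝ),
      jobsInSystem lam kap mu q.1.1 q.2.1 q.2.2 t =
        markedCount (inSystem lam kap mu q.1.1 t) (cumulative lam q.1.1 0 t) q.2.1 q.2.2 :=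
    fun q => jobsInSystem_eq_markedCount q.1.2 hlam _ _ t
  simp_rw [heq]
  refine measurable_ncard fun k => MeasurableSet.inter (measurableSet_le (hT k) hL) ?_
  exact (measurableSet_inSystem_uncurry hlam hkap hmu t).preimage
    (f := fun q : {f : ℝ≥0 → E // IsCadlag f} × (ℕ → ℝ) × (ℕ → ℝ) =>
      (q.1, ∑ i ∈ Finset.range (k + 1), q.2.1 i, q.2.2 k))
    (measurable_fst.prodMk ((hT k).prodMk (by fun_prop)))

lemma measurable_parameterIntegrand (hlam : Continuous lam) (hkap : Continuous kap)
    (hmu : Continuous mu) (t : ℝ≥0) :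
    Measurable (fun q : {f : ℝ≥0 → E // IsCadlag f} × ℝ => (lam (q.1.1 q.2.toNNReal) : ℝ) *
      Real.exp (-((kap (q.1.1 q.2.toNNReal) : ℝ) * cumulative mu q.1.1 q.2.toNNReal t))) := by
  have h1 := measurable_rate_cadlag hlam
  have h2 := measurable_rate_cadlag hkap
  have h3 := (measurable_cumulative hmu).comp
    (f := fun q : {f : ℝ≥0 → E // IsCadlag f} × ℝ => (q.1, q.2.toNNReal, t)) (by fun_prop)
  exact h1.mul (h2.mul h3).neg.exp

lemma measurable_randomParameter (hlam : Continuous lam) (hkap : Continuous kap)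
    (hmu : Continuous mu) (t : ℝ≥0) :
    Measurable (fun f : {f : ℝ≥0 → E // IsCadlag f} => randomParameter lam kap mu t f.1) := by
  have ht : (0 : ℝ) ≤ t := t.2
  simp only [randomParameter, intervalIntegral.integral_of_le ht]
  have h := (measurable_parameterIntegrand hlam hkap hmu t).stronglyMeasurable
  exact (h.integral_prod_right' (ν := volume.restrict (Ioc (0 : ℝ) t))).measurable

/-- The time change along the cumulative arrival rate. -/
lemma integral_markProb_inSystem (hf : IsCadlag f) (hlam : Continuous lam) (hkap : Continuous kap)
    (hmu : Continuous mu) (t : ℝ≥0) :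
    ∫ u in (0 : ℝ)..cumulative lam f 0 t, markProb (inSystem lam kap mu f t) u =
      randomParameter lam kap mu t f := by
  have hB := measurableSet_inSystem hf hlam hkap hmu t
  have hL : 0 ≤ cumulative lam f 0 t := cumulative_nonneg zero_le
  have ht : (0 : ℝ) ≤ t := t.2
  have hp := measurable_markProb hB
  have hw := hf.measurable_rate hlam
  have hi := hf.intervalIntegrable_rate hlam
  have hw0 : ∀ r : ℝ, (0 : ℝ) ≤ lam (f r.toNNReal) := fun r => NNReal.coe_nonneg _
  have hint : Measurable (fun s : ℝ => (lam (f s.toNNReal) : ℝ) *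
      Real.exp (-((kap (f s.toNNReal) : ℝ) * cumulative mu f s.toNNReal t))) :=
    (measurable_parameterIntegrand hlam hkap hmu t).comp
      (f := fun s : ℝ => ((⟨f, hf⟩ : {f : ℝ≥0 → E // IsCadlag f}), s)) (by fun_prop)
  rw [randomParameter, intervalIntegral.integral_of_le hL, intervalIntegral.integral_of_le ht,
    integral_eq_lintegral_of_nonneg_ae (Eventually.of_forall fun u =>
      show 0 ≤ markProb (inSystem lam kap mu f t) u from measureReal_nonneg)
      hp.aestronglyMeasurable,
    integral_eq_lintegral_of_nonneg_ae (Eventually.of_forall fun u => by positivity)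
      hint.aestronglyMeasurable]
  congr 1
  have hcv := lintegral_comp_primitive hw hw0 hi ht
    (g := fun u => ENNReal.ofReal (markProb (inSystem lam kap mu f t) u)) hp.ennreal_ofReal
  refine hcv.symm.trans (lintegral_congr_ae ?_)
  filter_upwards [ae_primitive_lt hw hw0 hi ht, ae_restrict_mem measurableSet_Ioc] with s hs hsI
  have hs0 : (s.toNNReal : ℝ) = s := Real.coe_toNNReal s hsI.1.le
  have hcum : ∫ r in (0 : ℝ)..s, (lam (f r.toNNReal) : ℝ) = cumulative lam f 0 s.toNNReal := by
    rw [cumulative, hs0, NNReal.coe_zero]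
  rw [ENNReal.ofReal_mul (NNReal.coe_nonneg _)]
  -- Where the arrival rate vanishes both integrands are zero; elsewhere first passage inverts the
  -- time change.
  rcases eq_or_ne ((lam (f s.toNNReal) : ℝ)) 0 with h0 | hne
  · rw [h0, ENNReal.ofReal_zero, zero_mul, zero_mul]
  · have hpass : firstPassage lam f (cumulative lam f 0 s.toNNReal) = s.toNNReal := by
      refine firstPassage_cumulative hf hlam fun s' hs' => ?_
      have := hs hne s' (by rw [← hs0]; exact_mod_cast hs')
      rwa [hcum] at this
    have hle : firstPassage lam f (cumulative lam f 0 s.toNNReal) ≤ t := by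
      rw [hpass]
      exact ENNReal.coe_le_coe.2 (Real.toNNReal_le_iff_le_coe.2 hsI.2)
    rw [hcum, markProb_inSystem hle, hpass, ENNReal.toNNReal_coe]

/-- For a fixed background path, the number of jobs in the system is Poisson distributed. -/
theorem map_jobsInSystem (hf : IsCadlag f) (hlam : Continuous lam) (hkap : Continuous kap)
    (hmu : Continuous mu) (t : ℝ≥0) :
    (expSeq.prod expSeq).map (fun q => jobsInSystem lam kap mu f q.1 q.2 t) =
      poissonMeasure (randomParameter lam kap mu t f).toNNReal := by
  simp_rw [jobsInSystem_eq_markedCount hf hlam]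
  rw [map_markedCount (measurableSet_inSystem hf hlam hkap hmu t) (cumulative_nonneg zero_le),
    integral_markProb_inSystem hf hlam hkap hmu]

end Path

/-! ### The law of the queue given the background process -/

lemma map_sumElim_expSeq : (expSeq.prod expSeq).map
    (fun q : (ℕ → ℝ) × (ℕ → ℝ) => (Sum.elim q.1 q.2 : ℕ ⊕ ℕ → ℝ)) =
      Measure.infinitePi (fun _ : ℕ ⊕ ℕ => expMeasure 1) := by
  have hm : Measurable (fun q : (ℕ → ℝ) × (ℕ → ℝ) => (Sum.elim q.1 q.2 : ℕ ⊕ ℕ → ℝ)) := by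
    refine measurable_pi_iff.2 fun i => ?_
    cases i with
    | inl k => exact (measurable_pi_apply k).comp measurable_fst
    | inr k => exact (measurable_pi_apply k).comp measurable_snd
  refine Measure.eq_infinitePi _ fun s t ht => ?_
  rw [Measure.map_apply hm (.pi s.countable_toSet fun _ _ => ht _)]
  have hpre : (fun q : (ℕ → ℝ) × (ℕ → ℝ) => (Sum.elim q.1 q.2 : ℕ ⊕ ℕ → ℝ)) ⁻¹'
      ((s : Set (ℕ ⊕ ℕ)).pi t) = ((s.toLeft : Set ℕ).pi fun k => t (Sum.inl k)) ×ˢ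
        ((s.toRight : Set ℕ).pi fun k => t (Sum.inr k)) := by
    ext q
    simp [Set.mem_pi]
  rw [hpre, Measure.prod_prod, expSeq, Measure.infinitePi_pi _ fun k _ => ht _,
    Measure.infinitePi_pi _ fun k _ => ht _, Finset.prod_sum_eq_prod_toLeft_mul_prod_toRight]

lemma randomParameter_natCast_mul {E : Type*} {lam kap mu : E → ℝ≥0} (f : ℝ≥0 → E)
    (t : ℝ≥0) (n : ℕ) : randomParameter (fun x => (n : ℝ≥0) * lam x) kap mu t f =
      n * randomParameter lam kap mu t f := by
  rw [randomParameter, randomParameter, ← intervalIntegral.integral_const_mul]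
  congr 1
  funext s
  push_cast
  ring

lemma randomParameter_nonneg {E : Type*} {lam kap mu : E → ℝ≥0} (f : ℝ≥0 → E) (t : ℝ≥0) :
    0 ≤ randomParameter lam kap mu t f :=
  intervalIntegral.integral_nonneg t.2 fun _ _ => by positivity

section Input

variable {Ω E : Type*} [MeasurableSpace Ω] [TopologicalSpace E] [MeasurableSpace E]
  {P : Measure Ω} {J : ℝ≥0 → Ω → E} {σ Z : ℕ → Ω → ℝ}

/-- The background process as a random element of the space of càdlàg paths. -/
def IsQueueInput.path (hQ : IsQueueInput P J σ Z) (ω : Ω) : {f : ℝ≥0 → E // IsCadlag f} :=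
  ⟨fun s => J s ω, hQ.cadlag ω⟩

lemma IsQueueInput.measurable_path (hQ : IsQueueInput P J σ Z) : Measurable hQ.path :=
  (measurable_pi_iff.2 hQ.measurable_background).subtype_mk

lemma IsQueueInput.measurable_exponentials (hQ : IsQueueInput P J σ Z) :
    Measurable (fun ω => ((fun k => σ k ω), (fun k => Z k ω))) :=
  (measurable_pi_iff.2 hQ.measurable_interarrival).prodMk
    (measurable_pi_iff.2 hQ.measurable_service)

lemma IsQueueInput.map_exponentials (hQ : IsQueueInput P J σ Z) :
    P.map (fun ω => ((fun k => σ k ω), (fun k => Z k ω))) = expSeq.prod expSeq := by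
  set split : (ℕ ⊕ ℕ → ℝ) → (ℕ → ℝ) × (ℕ → ℝ) :=
    fun y => ((fun k => y (Sum.inl k)), (fun k => y (Sum.inr k))) with hsplit
  have hsm : Measurable split := by fun_prop
  have hlaw : ∀ i : ℕ ⊕ ℕ, HasLaw (Sum.elim σ Z i) (expMeasure 1) P := fun i => by
    cases i with
    | inl k => exact hQ.law_interarrival k
    | inr k => exact hQ.law_service k
  have hmeas : ∀ i : ℕ ⊕ ℕ, Measurable (Sum.elim σ Z i) := fun i => by
    cases i with
    | inl k => exact hQ.measurable_interarrival k
    | inr k => exact hQ.measurable_service k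
  have hall : Measurable (fun ω (i : ℕ ⊕ ℕ) => Sum.elim σ Z i ω) := measurable_pi_iff.2 hmeas
  have h1 : P.map (fun ω (i : ℕ ⊕ ℕ) => Sum.elim σ Z i ω) =
      Measure.infinitePi (fun _ : ℕ ⊕ ℕ => expMeasure 1) := by
    rw [hQ.indep_exponentials.map_fun_eq_infinitePi_map hmeas]
    congr 1
    funext i
    exact (hlaw i).map_eq
  have hm : Measurable (fun q : (ℕ → ℝ) × (ℕ → ℝ) => (Sum.elim q.1 q.2 : ℕ ⊕ ℕ → ℝ)) := by
    refine measurable_pi_iff.2 fun i => ?_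
    cases i with
    | inl k => exact (measurable_pi_apply k).comp measurable_fst
    | inr k => exact (measurable_pi_apply k).comp measurable_snd
  have h2 := congrArg (Measure.map split) (h1.trans map_sumElim_expSeq.symm)
  rw [Measure.map_map hsm hall, Measure.map_map hsm hm] at h2
  exact h2.trans Measure.map_id

lemma IsQueueInput.indepFun_path (hQ : IsQueueInput P J σ Z) :
    IndepFun hQ.path (fun ω => ((fun k => σ k ω), (fun k => Z k ω))) P := by
  have h1 : IndepFun (fun ω (s : ℝ≥0) => J s ω)
      (fun ω => ((fun k => σ k ω), (fun k => Z k ω))) P :=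
    hQ.indep_background.comp measurable_id (ψ := fun y : ℕ ⊕ ℕ → ℝ =>
      ((fun k => y (Sum.inl k)), (fun k => y (Sum.inr k)))) (by fun_prop)
  rw [indepFun_iff_measure_inter_preimage_eq_mul] at h1 ⊢
  -- A measurable set of càdlàg paths is the trace of a product-measurable set `S`, so independence
  -- passes to the subtype.
  rintro _ T ⟨S, hS, rfl⟩ hT
  exact h1 S T hS hT

lemma IsQueueInput.map_path_exponentials [IsProbabilityMeasure P] (hQ : IsQueueInput P J σ Z) :
    P.map (fun ω => (hQ.path ω, (fun k => σ k ω), (fun k => Z k ω))) =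
      (P.map hQ.path).prod (expSeq.prod expSeq) := by
  rw [(indepFun_iff_map_prod_eq_prod_map_map hQ.measurable_path.aemeasurable
    hQ.measurable_exponentials.aemeasurable).1 hQ.indepFun_path, hQ.map_exponentials]

/-- Conditioning on the background process. -/
lemma IsQueueInput.measure_preimage [IsProbabilityMeasure P] (hQ : IsQueueInput P J σ Z)
    {F : {f : ℝ≥0 → E // IsCadlag f} × (ℕ → ℝ) × (ℕ → ℝ) → ℕ} (hF : Measurable F) (S : Set ℕ) :
    P ((fun ω => F (hQ.path ω, (fun k => σ k ω), (fun k => Z k ω))) ⁻¹' S) =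
      ∫⁻ f, (expSeq.prod expSeq).map (fun q => F (f, q)) S ∂(P.map hQ.path) := by
  have hS : MeasurableSet S := .of_discrete
  have h1 : Measurable (fun ω => (hQ.path ω, (fun k => σ k ω), (fun k => Z k ω))) :=
    hQ.measurable_path.prodMk hQ.measurable_exponentials
  have h2 : P ((fun ω => F (hQ.path ω, (fun k => σ k ω), (fun k => Z k ω))) ⁻¹' S) =
      P.map (fun ω => (hQ.path ω, (fun k => σ k ω), (fun k => Z k ω))) (F ⁻¹' S) := by
    rw [Measure.map_apply h1 (hF hS), preimage_preimage]
  rw [h2, hQ.map_path_exponentials, Measure.prod_apply (hF hS)]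
  refine lintegral_congr fun f => ?_
  exact (Measure.map_apply (hF.comp measurable_prodMk_left) hS).symm

variable [BorelSpace E] {lam kap mu : E → ℝ≥0}

lemma IsQueueInput.measurable_scaledJobs (hQ : IsQueueInput P J σ Z) (hlam : Continuous lam)
    (hkap : Continuous kap) (hmu : Continuous mu) (t : ℝ≥0) (n : ℕ) :
    Measurable (fun ω => (jobsInSystem (fun x => (n : ℝ≥0) * lam x) kap mu (fun s => J s ω)
      (fun k => σ k ω) (fun k => Z k ω) t : ℝ) / (n : ℝ)) := by
  have h := (measurable_jobsInSystem (hlam.const_mul (n : ℝ≥0)) hkap hmu t).comp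
    (hQ.measurable_path.prodMk hQ.measurable_exponentials)
  exact (measurable_from_nat (f := fun k : ℕ => (k : ℝ) / n)).comp h

/-- The scaled number of jobs is a mixture of scaled Poisson variables. -/
lemma IsQueueInput.scaledJobsLaw_apply [IsProbabilityMeasure P] (hQ : IsQueueInput P J σ Z)
    (hlam : Continuous lam) (hkap : Continuous kap) (hmu : Continuous mu) (t : ℝ≥0) (n : ℕ)
    {A : Set ℝ} (hA : MeasurableSet A) :
    scaledJobsLaw P lam kap mu J σ Z t n A =
      ∫⁻ f, poissonMeasure (n * (randomParameter lam kap mu t f.1).toNNReal)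
        {k : ℕ | (k : ℝ) / n ∈ A} ∂(P.map hQ.path) := by
  have hlam' : Continuous (fun x => (n : ℝ≥0) * lam x) := hlam.const_mul _
  have hjobs := measurable_jobsInSystem hlam' hkap hmu t
  rw [scaledJobsLaw, Measure.map_apply (hQ.measurable_scaledJobs hlam hkap hmu t n) hA]
  refine (hQ.measure_preimage hjobs {k : ℕ | (k : ℝ) / n ∈ A}).trans ?_
  refine lintegral_congr fun f => ?_
  rw [map_jobsInSystem f.2 hlam' hkap hmu t, randomParameter_natCast_mul,
    Real.toNNReal_mul n.cast_nonneg, Real.toNNReal_natCast]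

/-- Rewrites the law as the image of an `ℝ≥0`-valued function on path space, the form in which
`satisfiesLDP_mixedPoisson` takes its parameters. -/
lemma IsQueueInput.parameterLaw_eq (hQ : IsQueueInput P J σ Z) (hlam : Continuous lam)
    (hkap : Continuous kap) (hmu : Continuous mu) (t : ℝ≥0) :
    parameterLaw P lam kap mu J t = (P.map hQ.path).map
      (fun f => ((randomParameter lam kap mu t f.1).toNNReal : ℝ)) := by
  simp_rw [Real.coe_toNNReal _ (randomParameter_nonneg _ t)]
  rw [Measure.map_map (measurable_randomParameter hlam hkap hmu t) hQ.measurable_path]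
  rfl

end Input

end ModulatedQueue

/-! ### The large deviations principle for the queue -/

theorem theorem1 {E : Type*} [MetricSpace E] [MeasurableSpace E] [BorelSpace E]
    (lam kap mu : E → ℝ≥0) (hlam : Continuous lam) (hkap : Continuous kap) (hmu : Continuous mu)
    {Ω : ℕ → Type*} [∀ n, MeasurableSpace (Ω n)]
    (P : ∀ n, Measure (Ω n)) [∀ n, IsProbabilityMeasure (P n)]
    (J : ∀ n, ℝ≥0 → Ω n → E) (σ Z : ∀ n, ℕ → Ω n → ℝ)
    (hQ : ∀ n, ModulatedQueue.IsQueueInput (P n) (J n) (σ n) (Z n))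
    (t : ℝ≥0) (ψ : ℝ → ℝ≥0∞)
    (hψ : ModulatedQueue.SatisfiesLDP
      (fun n => ModulatedQueue.parameterLaw (P n) lam kap mu (J n) t) ψ) :
    ModulatedQueue.SatisfiesLDP
      (fun n => ModulatedQueue.scaledJobsLaw (P n) lam kap mu (J n) (σ n) (Z n) t n)
      (ModulatedQueue.mixedRate
        (fun n => ModulatedQueue.parameterLaw (P n) lam kap mu (J n) t) ψ) := by
  have hπ : ∀ n, IsProbabilityMeasure ((P n).map (hQ n).path) := fun n =>
    Measure.isProbabilityMeasure_map (hQ n).measurable_path.aemeasurable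
  have hν := fun n => (hQ n).parameterLaw_eq hlam hkap hmu t
  simp only [hν] at hψ ⊢
  exact ModulatedQueue.satisfiesLDP_mixedPoisson
    (fun _ => (ModulatedQueue.measurable_randomParameter hlam hkap hmu t).real_toNNReal) hψ
    (fun n _ A hA => (hQ n).scaledJobsLaw_apply hlam hkap hmu t n hA)
    fun n => Measure.isProbabilityMeasure_map
      ((hQ n).measurable_scaledJobs hlam hkap hmu t n).aemeasurable
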